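/- Let $\overline\alpha=0.583$ and $c_6=\frac{5}{18\sqrt3}$. For $\delta>0$ put $$V_\delta=\Big(\frac{c_6}{\delta(1-\overline\alpha)}\Big)^{\frac1{2-\overline\alpha}},\qquad Q_\delta=V_\delta^{1/2}\,[-\tfrac12,\tfrac12]^2\subset\mathbb R^2 .$$ Let $\mathcal A_\delta$ be the set of discrete measures $\mu=\sum_{i=1}^{N}m_i\delta_{z_i}$ with $N\in\mathbb N$, $m_i>0$, $\sum_i m_i=V_\delta$, and distinct points $z_i\in Q_\delta$. For $\mu\in\mathcal A_\delta$ let $$\mathcal F_\delta(\mu)=\frac{c_6}{1-\overline\alpha}\sum_{i=1}^{N}m_i^{\overline\alpha}+W_2^2(\mathbb 1_{Q_\delta},\mu),\qquad W_2^2(\mathbb 1_{Q_\delta},\mu)=\inf_T\int_{Q_\delta}|x-T(x)|^2\,dx,$$ where the infimum is over all Borel maps $T:Q_\delta\to\{z_1,\dots,z_N\}$ with $|T^{-1}(z_i)|=m_i$ for all $i$. There is $\delta_0>0$ such that for all $\delta\in(0,\delta_0)$ and every minimizer $\mu=\sum_{i=1}^{N}m_i\delta_{z_i}$ of $\mathcal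 F_\delta$ over $\mathcal A_\delta$ the following hold. (i) If $\mathrm{dist}(z_i,\partial Q_\delta)\ge 4$, then $m_i>\overline m:=2.0620\times10^{-4}$. (ii) If $\mathrm{dist}(z_i,\partial Q_\delta)<4$, then $m_i>m_{\mathrm b}:=1.5212\times10^{-5}$. (iii) If $B\subset Q_\delta$ is an open ball of radius $R$ that contains none of the points $z_i$, then $R<R_0:=3.3644$. (iv) The infimum defining $W_2^2(\mathbb 1_{Q_\delta},\mu)$ is attained, and every optimal map can be modified on a null set so that, for some weights $w_1,\dots,w_N\in\mathbb R$ and all $i$, $$\overline{T^{-1}(z_i)}=\{x\in Q_\delta:\ |x-z_i|^2-w_i\le|x-z_j|^2-w_j\ \text{for all }j\}.$$ For every optimal map $T$ normalized in this way and every $i$, $$\mathrm{diam}\big(T^{-1}(z_i)\big)\le D_0:=2\Big(8R_0^2+\frac{\overline\alpha}{1-\overline\alpha}\,c_6\,m_{\mathrm b}^{\overline\alpha-1}\Big)^{1/2}.$$ -/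

import Mathlib

open MeasureTheory
open scoped ENNReal Pointwise

noncomputable section

namespace Quantization

/-- The Euclidean plane. -/
abbrev Plane : Type := EuclideanSpace ℝ (Fin 2)

/-- The second moment about its centre of a regular hexagon of unit area. -/
def c6 : ℝ := 5 / (18 * √3)

/-- The exponent `0.583`. -/
def alphaBar : ℝ := 0.583

/-- The area of the rescaled square. -/
def vol (δ α : ℝ) : ℝ := (c6 / (δ * (1 - α))) ^ (1 / (2 - α))

/-- The closed unit square `[-1/2, 1/2]²`. -/
def unitSquare : Set Plane := {x | ∀ k, x k ∈ Set.Icc (-(1 / 2) : ℝ) (1 / 2)}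

/-- The rescaled square, of side length `V^{1/2}` with `V = vol δ α`. -/
def square (δ α : ℝ) : Set Plane := (vol δ α ^ (1 / 2 : ℝ)) • unitSquare

/-- An admissible discrete measure `∑ i, m i • δ_{z i}`: finitely many distinct atoms in the
rescaled square, with positive masses that add up to its area. Its support is `Set.range z`. -/
structure Admissible (δ α : ℝ) where
  N : ℕ
  m : Fin N → ℝ
  z : Fin N → Plane
  m_pos : ∀ i, 0 < m i
  sum_m : ∑ i, m i = vol δ α
  z_mem : ∀ i, z i ∈ square δ α
  z_inj : Function.Injective z

namespace Admissible

variable {δ α : ℝ}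

/-- The support of the measure. -/
def supp (μ : Admissible δ α) : Set Plane := Set.range μ.z

/-- The cell `T⁻¹(z i)` of a map `T`, regarded as a map on the rescaled square. -/
def cell (μ : Admissible δ α) (T : Plane → Plane) (i : Fin μ.N) : Set Plane :=
  {x ∈ square δ α | T x = μ.z i}

/-- `T` is a Borel map from the rescaled square to the atoms of `μ` which transports the Lebesgue
measure on the square to `μ`. The values of `T` outside the square play no role. -/
def IsTransportMap (μ : Admissible δ α) (T : Plane → Plane) : Prop :=
  Measurable T ∧ (∀ x ∈ square δ α, T x ∈ μ.supp) ∧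
    ∀ i, volume (μ.cell T i) = ENNReal.ofReal (μ.m i)

/-- The quadratic transport cost of `T` on the rescaled square. -/
def cost (δ α : ℝ) (T : Plane → Plane) : ℝ≥0∞ :=
  ∫⁻ x in square δ α, ENNReal.ofReal (‖x - T x‖ ^ 2)

/-- The squared Wasserstein distance from the Lebesgue measure on the rescaled square to `μ`. -/
def W2sq (μ : Admissible δ α) : ℝ≥0∞ :=
  ⨅ (T : Plane → Plane) (_ : μ.IsTransportMap T), cost δ α T

/-- The rescaled penalized energy. -/
def energy (μ : Admissible δ α) : ℝ≥0∞ :=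
  ENNReal.ofReal (c6 / (1 - α) * ∑ i, μ.m i ^ α) + μ.W2sq

/-- `μ` minimizes the rescaled penalized energy among all admissible measures. -/
def IsMinimizer (μ : Admissible δ α) : Prop :=
  ∀ ν : Admissible δ α, μ.energy ≤ ν.energy

/-- `T` attains the infimum that defines the Wasserstein distance. -/
def IsOptimalMap (μ : Admissible δ α) (T : Plane → Plane) : Prop :=
  μ.IsTransportMap T ∧ cost δ α T = μ.W2sq

/-- The Laguerre (power) cell of the `i`-th atom for the weights `w`. -/
def laguerreCell (μ : Admissible δ α) (w : Fin μ.N → ℝ) (i : Fin μ.N) : Set Plane :=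
  {x ∈ square δ α | ∀ j, ‖x - μ.z i‖ ^ 2 - w i ≤ ‖x - μ.z j‖ ^ 2 - w j}

/-- `T` is an optimal map normalized on a null set so that the closures of its cells are Laguerre
cells. (An optimal map is only determined up to null sets, and the diameter of a cell is not
invariant under changes on null sets.) -/
def IsLaguerreMap (μ : Admissible δ α) (T : Plane → Plane) : Prop :=
  μ.IsOptimalMap T ∧ ∃ w : Fin μ.N → ℝ, ∀ i, closure (μ.cell T i) = μ.laguerreCell w i

end Admissible

/-- The mass bound for cells whose particle is far from the boundary. -/
def mBar : ℝ := 2.0620 / 10 ^ 4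

/-- The mass bound for cells whose particle is close to the boundary. -/
def mB : ℝ := 1.5212 / 10 ^ 5

/-- The bound for the radius of particle-free balls. -/
def R0 : ℝ := 3.3644

/-- The bound for the diameter of the cells. -/
def D0 : ℝ :=
  2 * (8 * R0 ^ 2 + alphaBar / (1 - alphaBar) * c6 * mB ^ (alphaBar - 1)) ^ (1 / 2 : ℝ)

end Quantization

end

open Quantization

/-! All bounds come from comparing a minimizer with explicit competitors; a competitor is any finite
measurable partition of the square with points in the square (`exists_energy_le_of_isPartition`).

Write K = c6/(1-α). The mass term is strictly concave, so its derivative in the masses suggests the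
weights w_i = -Kα m_i^(α-1). The Laguerre partition for these weights minimizes the dual functional,
and tested as a competitor it contradicts the strict tangent inequality for t^α unless its cells
have exactly the masses m_i. Hence it is an optimal partition, which yields existence and the
Laguerre form of optimal maps without a separate duality theorem.

Two further competitors give the estimates. Inserting a particle in a particle-free ball shows that
every ball of radius 1.17 inside the square contains a particle (`IsMinimizer.exists_mem_ball`).
Merging two particles gives c6 m_i^(α-1) ≤ |z_i - z_j|² (`IsMinimizer.le_norm_sub_sq`), so a
particle with a close neighbour cannot be light. The diameter bound is the Laguerre inequality
against a nearby particle whose weight is controlled by its mass. Smallness of δ only serves to make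
the square large enough. -/

namespace Quantization

/-! ### Concavity of powers -/

/-- Bernoulli's strict inequality (1+s)^α < 1+αs at s = (b-a)/a, scaled by a^α. The value b = 0 is
admitted because a Laguerre cell may a priori be null. -/
theorem rpow_lt_tangent {a b α : ℝ} (ha : 0 < a) (hb : 0 ≤ b) (hab : b ≠ a) (h0 : 0 < α)
    (h1 : α < 1) : b ^ α < a ^ α + α * a ^ (α - 1) * (b - a) := by
  have hs : -1 ≤ (b - a) / a := by
    rw [le_div_iff₀ ha]; linarith
  have hs' : (b - a) / a ≠ 0 := div_ne_zero (sub_ne_zero.2 hab) ha.ne'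
  have h := _root_.rpow_one_add_lt_one_add_mul_self hs hs' h0 h1
  have e : b = a * (1 + (b - a) / a) := by field_simp; ring
  have hpow : 0 < a ^ α := Real.rpow_pos_of_pos ha α
  calc b ^ α = a ^ α * (1 + (b - a) / a) ^ α := by
        conv_lhs => rw [e]
        exact Real.mul_rpow ha.le (by linarith)
    _ < a ^ α * (1 + α * ((b - a) / a)) := mul_lt_mul_of_pos_left h hpow
    _ = a ^ α + α * a ^ (α - 1) * (b - a) := by
        rw [Real.rpow_sub_one ha.ne']; ring

theorem rpow_le_tangent {a b α : ℝ} (ha : 0 < a) (hb : 0 ≤ b) (h0 : 0 < α)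
    (h1 : α < 1) : b ^ α ≤ a ^ α + α * a ^ (α - 1) * (b - a) := by
  rcases eq_or_ne b a with rfl | h
  · simp
  · exact (rpow_lt_tangent ha hb h h0 h1).le

/-- Used to show that letting coinciding points share one atom does not raise the mass term. -/
theorem rpow_sum_le_sum_rpow {ι : Type*} (s : Finset ι) {f : ι → ℝ} (hf : ∀ i, 0 ≤ f i) {α : ℝ}
    (h0 : 0 < α) (h1 : α ≤ 1) : (∑ i ∈ s, f i) ^ α ≤ ∑ i ∈ s, f i ^ α := by
  classical
  induction s using Finset.induction_on with
  | empty => simp [h0.ne']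
  | insert a s ha ih =>
    rw [Finset.sum_insert ha, Finset.sum_insert ha]
    exact (Real.rpow_add_le_add_rpow (hf a) (Finset.sum_nonneg fun i _ => hf i) h0.le h1).trans
      (by gcongr)

/-- A lower bound for the defect of additivity of `t ↦ t ^ α`. -/
theorem subadditivity_defect {a b α : ℝ} (ha : 0 < a) (hb : 0 < b) (h0 : 0 < α) (h1 : α < 1) :
    (1 - α) * (a ^ α * (b / (a + b))) ≤ a ^ α + b ^ α - (a + b) ^ α := by
  have hpa : 0 < a ^ α := Real.rpow_pos_of_pos ha α
  have ea : a ^ (α - 1) * a = a ^ α := by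
    rw [Real.rpow_sub_one ha.ne']; field_simp
  have eb : b ^ (α - 1) * b = b ^ α := by
    rw [Real.rpow_sub_one hb.ne']; field_simp
  have hα : 0 < 1 - α := by linarith
  -- The tangent is taken at the larger of the two masses. The factor b/(a+b) is weaker than what
  -- either case gives, but it has the shape needed in the merging argument.
  rcases le_total a b with hab | hab
  · have h := rpow_le_tangent hb (by positivity : 0 ≤ a + b) h0 h1
    have hm : b ^ (α - 1) ≤ a ^ (α - 1) :=
      Real.rpow_le_rpow_of_nonpos ha hab (by linarith)
    have h2 : α * b ^ (α - 1) * (a + b - b) ≤ α * a ^ α := by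
      rw [← ea]
      have : b ^ (α - 1) * a ≤ a ^ (α - 1) * a := by gcongr
      nlinarith
    have h3 : b / (a + b) ≤ 1 := by rw [div_le_one (by positivity)]; linarith
    have h4 : (1 - α) * (a ^ α * (b / (a + b))) ≤ (1 - α) * (a ^ α * 1) := by gcongr
    linarith
  · have h := rpow_le_tangent ha (by positivity : 0 ≤ a + b) h0 h1
    have hm : a ^ (α - 1) ≤ b ^ (α - 1) :=
      Real.rpow_le_rpow_of_nonpos hb hab (by linarith)
    have h2 : a ^ (α - 1) * b ≤ b ^ α := by rw [← eb]; gcongr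
    have h3 : a ^ α * (b / (a + b)) ≤ a ^ (α - 1) * b := by
      rw [← ea, mul_assoc]
      have : a * (b / (a + b)) ≤ b := by
        rw [← mul_div_assoc, div_le_iff₀ (by positivity)]
        nlinarith
      gcongr
    have h4 : (1 - α) * (a ^ α * (b / (a + b))) ≤ (1 - α) * (a ^ (α - 1) * b) := by gcongr
    nlinarith

/-! ### The square -/

theorem c6_pos : 0 < c6 := by unfold c6; positivity

theorem vol_pos {δ α : ℝ} (hδ : 0 < δ) (h1 : α < 1) : 0 < vol δ α := by
  have := c6_pos
  have : 0 < 1 - α := by linarith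
  unfold vol; positivity

/-- The side length of the rescaled square. -/
noncomputable def side (δ α : ℝ) : ℝ := vol δ α ^ (1 / 2 : ℝ)

theorem side_pos {δ α : ℝ} (hδ : 0 < δ) (h1 : α < 1) : 0 < side δ α :=
  Real.rpow_pos_of_pos (vol_pos hδ h1) _

theorem side_sq {δ α : ℝ} (hδ : 0 < δ) (h1 : α < 1) : side δ α * side δ α = vol δ α := by
  unfold side
  rw [← Real.sqrt_eq_rpow, Real.mul_self_sqrt (vol_pos hδ h1).le]

theorem mem_square_iff {δ α : ℝ} (hδ : 0 < δ) (h1 : α < 1) {x : Plane} :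
    x ∈ square δ α ↔ ∀ k, x k ∈ Set.Icc (-(side δ α / 2)) (side δ α / 2) := by
  have hs := side_pos hδ h1
  change x ∈ side δ α • unitSquare ↔ _
  rw [Set.mem_smul_set_iff_inv_smul_mem₀ hs.ne']
  simp only [unitSquare, Set.mem_ofPred_eq, PiLp.smul_apply, smul_eq_mul, Set.mem_Icc]
  refine forall_congr' fun k => and_congr ?_ ?_
  · rw [inv_mul_eq_div, le_div_iff₀ hs]
    constructor <;> intro h <;> linarith
  · rw [inv_mul_eq_div, div_le_iff₀ hs]
    constructor <;> intro h <;> linarith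

theorem square_eq_preimage {δ α : ℝ} (hδ : 0 < δ) (h1 : α < 1) :
    square δ α = (WithLp.ofLp : Plane → Fin 2 → ℝ) ⁻¹'
      (Set.Icc (fun _ => -(side δ α / 2)) (fun _ => side δ α / 2)) := by
  ext x
  rw [mem_square_iff hδ h1]
  simp only [Set.mem_preimage, Set.mem_Icc, Pi.le_def]
  exact forall_and

theorem isClosed_square {δ α : ℝ} (hδ : 0 < δ) (h1 : α < 1) : IsClosed (square δ α) := by
  rw [square_eq_preimage hδ h1]
  exact isClosed_Icc.preimage (PiLp.continuous_ofLp 2 _)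

theorem convex_square {δ α : ℝ} (hδ : 0 < δ) (h1 : α < 1) : Convex ℝ (square δ α) := by
  intro x hx y hy a b ha hb hab
  rw [mem_square_iff hδ h1] at *
  intro k
  exact (convex_Icc (𝕜 := ℝ) _ _) (hx k) (hy k) ha hb hab

theorem measurableSet_square {δ α : ℝ} (hδ : 0 < δ) (h1 : α < 1) : MeasurableSet (square δ α) :=
  (isClosed_square hδ h1).measurableSet

theorem volume_square {δ α : ℝ} (hδ : 0 < δ) (h1 : α < 1) :
    volume (square δ α) = ENNReal.ofReal (vol δ α) := by
  rw [square_eq_preimage hδ h1,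
    (PiLp.volume_preserving_ofLp (Fin 2)).measure_preimage measurableSet_Icc.nullMeasurableSet,
    Real.volume_Icc_pi]
  have hs := side_pos hδ h1
  simp only [sub_neg_eq_add, add_halves, Fin.prod_univ_two]
  rw [← ENNReal.ofReal_mul hs.le, side_sq hδ h1]

theorem isBounded_square {δ α : ℝ} (hδ : 0 < δ) (h1 : α < 1) :
    Bornology.IsBounded (square δ α) := by
  rw [isBounded_iff_forall_norm_le]
  refine ⟨√(side δ α ^ 2), fun x hx => ?_⟩
  rw [mem_square_iff hδ h1] at hx
  rw [EuclideanSpace.norm_eq, Fin.sum_univ_two]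
  have hs := side_pos hδ h1
  apply Real.sqrt_le_sqrt
  have h0 := hx 0
  have h2 := hx 1
  simp only [Set.mem_Icc] at h0 h2
  simp only [Real.norm_eq_abs, sq_abs]
  nlinarith

/-- The ball is connected, misses the frontier and has its centre in the interior, so it cannot
reach the complement. -/
theorem ball_subset_square_of_frontier {δ α r : ℝ} (hδ : 0 < δ) (h1 : α < 1) {x : Plane}
    (hx : x ∈ square δ α) (hr : r ≤ Metric.infDist x (frontier (square δ α))) :
    Metric.ball x r ⊆ square δ α := by
  rcases le_or_gt r 0 with h0 | h0
  · simp [Metric.ball_eq_empty.2 h0]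
  have hfr : ∀ y ∈ Metric.ball x r, y ∉ frontier (square δ α) := fun y hy hyf => by
    have h := Metric.infDist_le_dist_of_mem (x := x) hyf
    rw [Metric.mem_ball'] at hy
    linarith
  have hcl := isClosed_square hδ h1
  refine (IsPreconnected.subset_left_of_subset_union isOpen_interior hcl.isOpen_compl
    (disjoint_compl_right.mono_left interior_subset) ?_ ?_
    (convex_ball x r).isPreconnected).trans interior_subset
  · intro y hy
    by_contra hn
    rw [Set.mem_union, not_or, Set.mem_compl_iff, not_not] at hn
    exact hfr y hy ⟨subset_closure hn.2, hn.1⟩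
  · have hxb := Metric.mem_ball_self (x := x) h0
    refine ⟨x, hxb, ?_⟩
    by_contra hn
    exact hfr x hxb ⟨subset_closure hx, hn⟩

/-! ### Finite measurable partitions and their second moments -/

/-- A measurable partition of `Q`, indexed by `ι`; empty members are allowed. -/
structure IsPartition {ι : Type*} (Q : Set Plane) (A : ι → Set Plane) : Prop where
  measurableSet : ∀ i, MeasurableSet (A i)
  disjoint : Pairwise (Function.onFun Disjoint A)
  iUnion_eq : ⋃ i, A i = Q

/-- The second moment of `A` about the point `p`. -/
noncomputable def moment (A : Set Plane) (p : Plane) : ℝ := ∫ x in A, ‖x - p‖ ^ 2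

theorem moment_nonneg (A : Set Plane) (p : Plane) : 0 ≤ moment A p :=
  integral_nonneg fun _ => by positivity

theorem moment_of_volume_eq_zero {A : Set Plane} (hA : volume A = 0) (p : Plane) :
    moment A p = 0 := setIntegral_measure_zero _ hA

theorem IsPartition.subset {ι : Type*} {Q : Set Plane} {A : ι → Set Plane}
    (h : IsPartition Q A) (i : ι) : A i ⊆ Q := h.iUnion_eq ▸ Set.subset_iUnion A i

theorem IsPartition.exists_mem {ι : Type*} {Q : Set Plane} {A : ι → Set Plane}
    (h : IsPartition Q A) {x : Plane} (hx : x ∈ Q) : ∃ i, x ∈ A i := by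
  rwa [← h.iUnion_eq, Set.mem_iUnion] at hx

theorem isCompact_square {δ α : ℝ} (hδ : 0 < δ) (h1 : α < 1) : IsCompact (square δ α) :=
  Metric.isCompact_of_isClosed_isBounded (isClosed_square hδ h1) (isBounded_square hδ h1)

theorem integrableOn_of_subset_isCompact {E : Type*} [NormedAddCommGroup E] {Q A : Set Plane}
    (hQ : IsCompact Q) (hA : A ⊆ Q) {f : Plane → E} (hf : Continuous f) :
    IntegrableOn f A := (hf.continuousOn.integrableOn_compact hQ).mono_set hA

theorem IsPartition.volume_ne_top {ι : Type*} {Q : Set Plane} {A : ι → Set Plane}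
    (h : IsPartition Q A) (hQ : IsCompact Q) (i : ι) : volume (A i) ≠ ⊤ :=
  (measure_mono (h.subset i)).trans_lt hQ.measure_lt_top |>.ne

theorem IsPartition.sum_volume {ι : Type*} [Fintype ι] {Q : Set Plane} {A : ι → Set Plane}
    (h : IsPartition Q A) (hQ : IsCompact Q) :
    ∑ i, volume.real (A i) = volume.real Q := by
  rw [← h.iUnion_eq, measureReal_def,
    measure_iUnion h.disjoint h.measurableSet, tsum_fintype,
    ENNReal.toReal_sum fun i _ => h.volume_ne_top hQ i]
  rfl

theorem IsPartition.lintegral_eq {ι : Type*} [Fintype ι] {Q : Set Plane} {A : ι → Set Plane}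
    (h : IsPartition Q A) (hQ : IsCompact Q) (p : ι → Plane) {T : Plane → Plane}
    (hT : ∀ i, ∀ x ∈ A i, T x = p i) :
    ∫⁻ x in Q, ENNReal.ofReal (‖x - T x‖ ^ 2) = ENNReal.ofReal (∑ i, moment (A i) (p i)) := by
  conv_lhs => rw [← h.iUnion_eq]
  rw [lintegral_iUnion h.measurableSet h.disjoint, tsum_fintype,
    ENNReal.ofReal_sum_of_nonneg fun i _ => moment_nonneg _ _]
  refine Finset.sum_congr rfl fun i _ => ?_
  rw [moment, ofReal_integral_eq_lintegral_ofReal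
    (integrableOn_of_subset_isCompact hQ (h.subset i) (by fun_prop))
    (ae_of_all _ fun x => by positivity)]
  exact setLIntegral_congr_fun (h.measurableSet i) fun x hx => by simp only [hT i x hx]

/-- A partition with a choice of points is realized by a measurable map. -/
theorem IsPartition.exists_map {ι : Type*} [Fintype ι] {Q : Set Plane} {A : ι → Set Plane}
    (h : IsPartition Q A) (p : ι → Plane) :
    ∃ T : Plane → Plane, Measurable T ∧ ∀ i, ∀ x ∈ A i, T x = p i := by
  classical
  refine ⟨fun x => ∑ i, (A i).indicator (fun _ => p i) x,
    Finset.measurable_sum _ fun i _ => measurable_const.indicator (h.measurableSet i),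
    fun i x hx => ?_⟩
  beta_reduce
  rw [Finset.sum_eq_single i]
  · exact Set.indicator_of_mem hx _
  · intro j _ hj
    exact Set.indicator_of_notMem (fun hxj => Set.disjoint_left.1 (h.disjoint hj) hxj hx) _
  · simp

/-! ### Transport maps as partitions, and partitions as competitors -/

namespace Admissible

variable {δ α : ℝ}

theorem IsTransportMap.isPartition {μ : Admissible δ α} {T : Plane → Plane}
    (hT : μ.IsTransportMap T) (hδ : 0 < δ) (h1 : α < 1) :
    IsPartition (square δ α) (μ.cell T) where
  measurableSet i := (measurableSet_square hδ h1).inter (hT.1 (measurableSet_singleton _))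
  disjoint i j hij := Set.disjoint_left.2 fun x hx hx' => hij (μ.z_inj (hx.2.symm.trans hx'.2))
  iUnion_eq := by
    ext x
    simp only [Set.mem_iUnion]
    constructor
    · rintro ⟨i, hi⟩
      exact hi.1
    · intro hx
      obtain ⟨i, hi⟩ := hT.2.1 x hx
      exact ⟨i, hx, hi.symm⟩

theorem IsTransportMap.volume_cell {μ : Admissible δ α} {T : Plane → Plane}
    (hT : μ.IsTransportMap T) (i : Fin μ.N) : volume.real (μ.cell T i) = μ.m i := by
  rw [measureReal_def, hT.2.2 i, ENNReal.toReal_ofReal (μ.m_pos i).le]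

theorem IsTransportMap.cost_eq {μ : Admissible δ α} {T : Plane → Plane}
    (hT : μ.IsTransportMap T) (hδ : 0 < δ) (h1 : α < 1) :
    cost δ α T = ENNReal.ofReal (∑ i, moment (μ.cell T i) (μ.z i)) :=
  (hT.isPartition hδ h1).lintegral_eq (isCompact_square hδ h1) μ.z fun _ _ hx => hx.2

theorem cell_eq_of_isPartition {μ : Admissible δ α} {T : Plane → Plane}
    {A : Fin μ.N → Set Plane} (hA : IsPartition (square δ α) A)
    (hT : ∀ i, ∀ x ∈ A i, T x = μ.z i) (i : Fin μ.N) : μ.cell T i = A i := by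
  ext x
  constructor
  · rintro ⟨hx, hTx⟩
    obtain ⟨j, hj⟩ := hA.exists_mem hx
    rw [hT j x hj] at hTx
    rwa [← μ.z_inj hTx]
  · exact fun hx => ⟨hA.subset i hx, hT i x hx⟩

theorem isTransportMap_of_isPartition {μ : Admissible δ α} {T : Plane → Plane}
    {A : Fin μ.N → Set Plane} (hA : IsPartition (square δ α) A) (hδ : 0 < δ) (h1 : α < 1)
    (hTm : Measurable T) (hT : ∀ i, ∀ x ∈ A i, T x = μ.z i)
    (hvol : ∀ i, volume.real (A i) = μ.m i) : μ.IsTransportMap T := by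
  refine ⟨hTm, fun x hx => ?_, fun i => ?_⟩
  · obtain ⟨j, hj⟩ := hA.exists_mem hx
    exact ⟨j, (hT j x hj).symm⟩
  · rw [cell_eq_of_isPartition hA hT i, ← hvol i, measureReal_def,
      ENNReal.ofReal_toReal (hA.volume_ne_top (isCompact_square hδ h1) i)]

/-- Partitions of the square with points in the square are competitors; repeated points are
merged, and members of measure zero are reassigned. -/
theorem exists_energy_le_of_isPartition {ι : Type*} [Fintype ι] {A : ι → Set Plane}
    (hA : IsPartition (square δ α) A) (hδ : 0 < δ) (h0 : 0 < α) (h1 : α < 1)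
    {p : ι → Plane} (hp : ∀ i, p i ∈ square δ α) :
    ∃ ν : Admissible δ α, ν.energy ≤ ENNReal.ofReal
      (c6 / (1 - α) * ∑ i, volume.real (A i) ^ α + ∑ i, moment (A i) (p i)) := by
  classical
  have hQ := isCompact_square hδ h1
  have hsum : ∑ i, volume.real (A i) = vol δ α := by
    rw [hA.sum_volume hQ, measureReal_def, volume_square hδ h1,
      ENNReal.toReal_ofReal (vol_pos hδ h1).le]
  obtain ⟨i₀, -, hi₀⟩ : ∃ i ∈ Finset.univ, 0 < volume.real (A i) := by
    apply Finset.exists_lt_of_sum_lt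
    simpa [hsum] using vol_pos hδ h1
  -- Atoms must have positive mass, so null members are sent to a point already carrying mass; their
  -- moments vanish in any case.
  set q : ι → Plane := fun i => if 0 < volume.real (A i) then p i else p i₀ with hq
  have hqQ : ∀ i, q i ∈ square δ α := fun i => by
    simp only [hq]; split_ifs <;> exact hp _
  have hqm : ∀ i, moment (A i) (q i) = moment (A i) (p i) := fun i => by
    simp only [hq]
    split_ifs with h
    · rfl
    · have h' : volume (A i) = 0 := by
        have h2 : volume.real (A i) = 0 := le_antisymm (not_lt.1 h) measureReal_nonneg
        rwa [measureReal_eq_zero_iff (hA.volume_ne_top hQ i)] at h2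
      rw [moment_of_volume_eq_zero h', moment_of_volume_eq_zero h']
  set F : Finset Plane := Finset.univ.image q with hF
  set e := F.equivFin with he
  -- The mass of an atom is the total volume of the members sent to it.
  set M : Plane → ℝ := fun y => ∑ i with q i = y, volume.real (A i) with hM
  have hMpos : ∀ y ∈ F, 0 < M y := by
    intro y hy
    obtain ⟨i, -, rfl⟩ := Finset.mem_image.1 hy
    refine Finset.sum_pos' (fun j _ => measureReal_nonneg) ?_
    by_cases h : 0 < volume.real (A i)
    · exact ⟨i, by simp, h⟩
    · refine ⟨i₀, ?_, hi₀⟩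
      simp [hq, h, hi₀]
  have hsumF : ∀ g : Plane → ℝ, ∑ k : Fin F.card, g (e.symm k) = ∑ y ∈ F, g y := fun g => by
    rw [← Finset.sum_coe_sort F g]
    exact Equiv.sum_comp e.symm (fun y : F => g y)
  have hmaps : ∀ i ∈ Finset.univ, q i ∈ F := fun i _ =>
    Finset.mem_image_of_mem q (Finset.mem_univ i)
  let ν : Admissible δ α :=
    { N := F.card
      m := fun k => M (e.symm k)
      z := fun k => e.symm k
      m_pos := fun k => hMpos _ (e.symm k).2
      sum_m := by
        rw [hsumF M, ← hsum]
        exact Finset.sum_fiberwise_of_maps_to hmaps _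
      z_mem := fun k => by
        obtain ⟨i, -, hi⟩ := Finset.mem_image.1 (e.symm k).2
        rw [← hi]
        exact hqQ i
      z_inj := Subtype.val_injective.comp e.symm.injective }
  obtain ⟨T, hTm, hT⟩ := hA.exists_map q
  have hTν : ν.IsTransportMap T := by
    refine ⟨hTm, fun x hx => ?_, fun k => ?_⟩
    · obtain ⟨i, hi⟩ := hA.exists_mem hx
      refine ⟨e ⟨q i, hmaps i (Finset.mem_univ i)⟩, ?_⟩
      rw [hT i x hi]
      change ((e.symm (e ⟨q i, _⟩) : F) : Plane) = q i
      rw [Equiv.symm_apply_apply]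
    · have hcell : ν.cell T k = ⋃ i ∈ Finset.univ.filter fun i => q i = ν.z k, A i := by
        ext x
        simp only [Finset.mem_filter, Finset.mem_univ, true_and, Set.mem_iUnion, exists_prop]
        constructor
        · rintro ⟨hx, hTx⟩
          obtain ⟨i, hi⟩ := hA.exists_mem hx
          exact ⟨i, (hT i x hi).symm.trans hTx, hi⟩
        · rintro ⟨i, hi, hx⟩
          exact ⟨hA.subset i hx, (hT i x hx).trans hi⟩
      rw [hcell, measure_biUnion_finset (fun i _ j _ hij => hA.disjoint hij)
        fun i _ => hA.measurableSet i]
      change _ = ENNReal.ofReal (∑ i with q i = ν.z k, volume.real (A i))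
      rw [ENNReal.ofReal_sum_of_nonneg fun _ _ => measureReal_nonneg]
      exact Finset.sum_congr rfl fun i _ =>
        (ENNReal.ofReal_toReal (hA.volume_ne_top hQ i)).symm
  refine ⟨ν, ?_⟩
  have hK : 0 ≤ c6 / (1 - α) := div_nonneg c6_pos.le (by linarith)
  have hW : ν.W2sq ≤ ENNReal.ofReal (∑ i, moment (A i) (p i)) := by
    refine (iInf₂_le T hTν).trans_eq ?_
    rw [cost, hA.lintegral_eq hQ q hT]
    simp only [hqm]
  have hS : ∑ k, ν.m k ^ α ≤ ∑ i, volume.real (A i) ^ α := by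
    change ∑ k : Fin F.card, M (e.symm k) ^ α ≤ _
    rw [hsumF fun y => M y ^ α, ← Finset.sum_fiberwise_of_maps_to hmaps]
    exact Finset.sum_le_sum fun y _ => rpow_sum_le_sum_rpow _ (fun _ => measureReal_nonneg) h0 h1.le
  rw [ENNReal.ofReal_add (mul_nonneg hK (Finset.sum_nonneg fun i _ => by positivity))
    (Finset.sum_nonneg fun i _ => moment_nonneg _ _)]
  exact add_le_add (ENNReal.ofReal_le_ofReal (mul_le_mul_of_nonneg_left hS hK)) hW

end Admissible

/-! ### Convex sets and null sets -/

/-- The frontier of a convex set is null, so positive volume forces a nonempty interior, which is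
then dense in the set. Deleting a null set from a nonempty open set keeps it dense. -/
theorem subset_closure_interior_diff {C N : Set Plane} (hC : Convex ℝ C) (hcl : IsClosed C)
    (hpos : volume C ≠ 0) (hN : volume N = 0) : C ⊆ closure (interior C \ N) := by
  have hne : (interior C).Nonempty := by
    rw [Set.nonempty_iff_ne_empty]
    intro h
    apply hpos
    refine measure_mono_null ?_ (hC.addHaar_frontier volume)
    rw [hcl.frontier_eq, h, Set.sdiff_empty]
  have h1 : C ⊆ closure (interior C) := by
    rw [hC.closure_interior_eq_closure_of_nonempty_interior hne]
    exact subset_closure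
  refine h1.trans (closure_minimal ?_ isClosed_closure)
  intro x hx
  rw [mem_closure_iff]
  intro U hU hxU
  by_contra hemp
  rw [Set.not_nonempty_iff_eq_empty] at hemp
  have hsub : U ∩ interior C ⊆ N := fun y hy => by
    by_contra hyN
    exact (Set.eq_empty_iff_forall_notMem.1 hemp) y ⟨hy.1, hy.2, hyN⟩
  exact (hU.inter isOpen_interior).measure_ne_zero volume ⟨x, hxU, hx⟩ (measure_mono_null hsub hN)

theorem norm_sub_sq_sub_norm_sub_sq (x a b : Plane) :
    ‖x - a‖ ^ 2 - ‖x - b‖ ^ 2 = 2 * inner ℝ (b - a) x + (‖a‖ ^ 2 - ‖b‖ ^ 2) := by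
  rw [norm_sub_sq_real, norm_sub_sq_real, inner_sub_left, real_inner_comm x a, real_inner_comm x b]
  ring

/-- The quadratic terms cancel, so the set is empty or a translate of the kernel of a nonzero linear
functional. -/
theorem volume_tie_eq_zero {a b : Plane} (hab : a ≠ b) (u v : ℝ) :
    volume {x : Plane | ‖x - a‖ ^ 2 - u = ‖x - b‖ ^ 2 - v} = 0 := by
  set S := {x : Plane | ‖x - a‖ ^ 2 - u = ‖x - b‖ ^ 2 - v} with hS
  rcases S.eq_empty_or_nonempty with h | ⟨y, hy⟩
  · rw [h, measure_empty]
  set H : Submodule ℝ Plane := LinearMap.ker (innerSL ℝ (b - a)).toLinearMap with hH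
  have hHtop : H ≠ ⊤ := by
    intro h
    have h2 : b - a ∈ H := h ▸ Submodule.mem_top
    have h3 : inner ℝ (b - a) (b - a) = 0 := h2
    exact hab (sub_eq_zero.1 (inner_self_eq_zero.1 h3)).symm
  have hsub : S = (fun x => x + -y) ⁻¹' (H : Set Plane) := by
    ext x
    have hx := norm_sub_sq_sub_norm_sub_sq x a b
    have hy' := norm_sub_sq_sub_norm_sub_sq y a b
    have hyS : ‖y - a‖ ^ 2 - u = ‖y - b‖ ^ 2 - v := hy
    have hmem : x + -y ∈ (H : Set Plane) ↔ inner ℝ (b - a) (x + -y) = 0 := Iff.rfl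
    rw [Set.mem_preimage, hmem, inner_add_right, inner_neg_right]
    change ‖x - a‖ ^ 2 - u = ‖x - b‖ ^ 2 - v ↔ _
    constructor <;> intro h <;> linarith
  rw [hsub, measure_preimage_add_right]
  exact Measure.addHaar_submodule volume H hHtop

/-! ### Integrals over partitions -/

theorem IsPartition.sum_setIntegral {ι : Type*} [Fintype ι] {Q : Set Plane} {A : ι → Set Plane}
    (h : IsPartition Q A) (hQ : IsCompact Q) {f : Plane → ℝ} (hf : Continuous f) :
    ∑ i, ∫ x in A i, f x = ∫ x in Q, f x := by
  conv_rhs => rw [← h.iUnion_eq]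
  exact (integral_iUnion_fintype h.measurableSet h.disjoint fun i =>
    integrableOn_of_subset_isCompact hQ (h.subset i) hf).symm

theorem setIntegral_power {Q A : Set Plane} (hQ : IsCompact Q) (hA : A ⊆ Q) (p : Plane) (w : ℝ) :
    ∫ x in A, (‖x - p‖ ^ 2 - w) = moment A p - w * volume.real A := by
  rw [integral_sub (integrableOn_of_subset_isCompact hQ hA (by fun_prop))
    (integrableOn_of_subset_isCompact hQ hA continuous_const), setIntegral_const, smul_eq_mul,
    mul_comm w]
  rfl

theorem exists_continuous_min {ι : Type*} [Fintype ι] [Nonempty ι] {h : ι → Plane → ℝ}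
    (hh : ∀ i, Continuous (h i)) :
    ∃ φ : Plane → ℝ, Continuous φ ∧ (∀ x i, φ x ≤ h i x) ∧ ∀ x, ∃ i, φ x = h i x := by
  refine ⟨fun x => Finset.univ.inf' Finset.univ_nonempty fun i => h i x,
    Continuous.finset_inf'_apply _ fun i _ => hh i,
    fun x i => Finset.inf'_le _ (Finset.mem_univ i), fun x => ?_⟩
  obtain ⟨i, -, hi⟩ := Finset.exists_mem_eq_inf' Finset.univ_nonempty fun i => h i x
  exact ⟨i, hi⟩

/-- Among all partitions, those into sets on which the corresponding function is the smallest one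
minimize the sum of the integrals, and they are essentially the only ones. -/
theorem sum_setIntegral_le_of_min {ι : Type*} [Fintype ι] [Nonempty ι] {Q : Set Plane}
    (hQ : IsCompact Q) {h : ι → Plane → ℝ} (hh : ∀ i, Continuous (h i)) {A C : ι → Set Plane}
    (hA : IsPartition Q A) (hC : IsPartition Q C) (hmin : ∀ i, ∀ x ∈ C i, ∀ j, h i x ≤ h j x) :
    ∑ i, ∫ x in C i, h i x ≤ ∑ i, ∫ x in A i, h i x ∧
    (∑ i, ∫ x in C i, h i x = ∑ i, ∫ x in A i, h i x →
      ∀ i, ∀ᵐ x ∂volume.restrict (A i), ∀ j, h i x ≤ h j x) := by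
  obtain ⟨φ, hφ, hle, hex⟩ := exists_continuous_min hh
  -- On the minimizing partition the integrand is the pointwise minimum φ, whose integral over Q can
  -- be regrouped along any other partition.
  have hCφ : ∑ i, ∫ x in C i, h i x = ∑ i, ∫ x in A i, φ x := by
    rw [hA.sum_setIntegral hQ hφ, ← hC.sum_setIntegral hQ hφ]
    refine Finset.sum_congr rfl fun i _ => setIntegral_congr_fun (hC.measurableSet i) fun x hx => ?_
    obtain ⟨j, hj⟩ := hex x
    exact le_antisymm (hj ▸ hmin i x hx j) (hle x i)
  have hint : ∀ i, IntegrableOn (h i) (A i) := fun i =>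
    integrableOn_of_subset_isCompact hQ (hA.subset i) (hh i)
  have hintφ : ∀ i, IntegrableOn φ (A i) := fun i =>
    integrableOn_of_subset_isCompact hQ (hA.subset i) hφ
  have hpt : ∀ i ∈ Finset.univ, ∫ x in A i, φ x ≤ ∫ x in A i, h i x := fun i _ =>
    integral_mono (hintφ i) (hint i) fun x => hle x i
  rw [hCφ]
  refine ⟨Finset.sum_le_sum hpt, fun heq i => ?_⟩
  have hi := (Finset.sum_eq_sum_iff_of_le hpt).1 heq i (Finset.mem_univ i)
  have h0 : ∫ x in A i, (h i x - φ x) = 0 := by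
    rw [integral_sub (hint i) (hintφ i), hi, sub_self]
  have h2 := (integral_eq_zero_iff_of_nonneg (fun x => sub_nonneg.2 (hle x i))
    ((hint i).sub (hintφ i))).1 h0
  filter_upwards [h2] with x hx j
  have : h i x - φ x = 0 := hx
  linarith [hle x j]

namespace Admissible

variable {δ α : ℝ}

/-! ### Laguerre cells -/

theorem isClosed_laguerreCell (μ : Admissible δ α) (hδ : 0 < δ) (h1 : α < 1)
    (w : Fin μ.N → ℝ) (i : Fin μ.N) : IsClosed (μ.laguerreCell w i) := by
  have : μ.laguerreCell w i = square δ α ∩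
      ⋂ j, {x | ‖x - μ.z i‖ ^ 2 - w i ≤ ‖x - μ.z j‖ ^ 2 - w j} := by
    ext x; simp [laguerreCell]
  rw [this]
  exact (isClosed_square hδ h1).inter
    (isClosed_iInter fun j => isClosed_le (by fun_prop) (by fun_prop))

theorem convex_laguerreCell (μ : Admissible δ α) (hδ : 0 < δ) (h1 : α < 1)
    (w : Fin μ.N → ℝ) (i : Fin μ.N) : Convex ℝ (μ.laguerreCell w i) := by
  have : μ.laguerreCell w i = square δ α ∩
      ⋂ j, {x | innerSL ℝ (μ.z j - μ.z i) x ≤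
        (w i - w j - (‖μ.z i‖ ^ 2 - ‖μ.z j‖ ^ 2)) / 2} := by
    ext x
    simp only [laguerreCell, Set.mem_inter_iff, Set.mem_iInter]
    refine and_congr Iff.rfl (forall_congr' fun j => ?_)
    have h := norm_sub_sq_sub_norm_sub_sq x (μ.z i) (μ.z j)
    change _ ↔ inner ℝ (μ.z j - μ.z i) x ≤ _
    constructor <;> intro h' <;> linarith
  rw [this]
  exact (convex_square hδ h1).inter (convex_iInter fun j =>
    convex_halfSpace_le (innerSL ℝ (μ.z j - μ.z i)).toLinearMap.isLinear _)

/-- The union of the lines that separate the Laguerre cells. -/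
def ties (μ : Admissible δ α) (w : Fin μ.N → ℝ) : Set Plane :=
  ⋃ i, ⋃ j, ⋃ (_ : i ≠ j), {x | ‖x - μ.z i‖ ^ 2 - w i = ‖x - μ.z j‖ ^ 2 - w j}

theorem volume_ties (μ : Admissible δ α) (w : Fin μ.N → ℝ) : volume (μ.ties w) = 0 := by
  simp only [ties, measure_iUnion_null_iff]
  exact fun i j hij => volume_tie_eq_zero (μ.z_inj.ne hij) _ _

theorem eq_of_mem_laguerreCell {μ : Admissible δ α} {w : Fin μ.N → ℝ} {i j : Fin μ.N} {x : Plane}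
    (hi : x ∈ μ.laguerreCell w i) (hj : x ∈ μ.laguerreCell w j) (hx : x ∉ μ.ties w) : i = j := by
  by_contra hij
  apply hx
  simp only [ties, Set.mem_iUnion]
  exact ⟨i, j, hij, le_antisymm (hi.2 j) (hj.2 i)⟩

/-- The Laguerre cells, with ties broken by the order of the indices. -/
def laguerrePartition (μ : Admissible δ α) (w : Fin μ.N → ℝ) (i : Fin μ.N) : Set Plane :=
  {x ∈ μ.laguerreCell w i | ∀ j < i, x ∉ μ.laguerreCell w j}

theorem N_pos (μ : Admissible δ α) (hδ : 0 < δ) (h1 : α < 1) : Nonempty (Fin μ.N) := by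
  rw [← Fin.pos_iff_nonempty, Nat.pos_iff_ne_zero]
  intro h
  have : IsEmpty (Fin μ.N) := by rw [h]; infer_instance
  have h2 := μ.sum_m
  rw [Finset.univ_eq_empty, Finset.sum_empty] at h2
  exact (vol_pos hδ h1).ne h2

theorem isPartition_laguerrePartition (μ : Admissible δ α) (hδ : 0 < δ) (h1 : α < 1)
    (w : Fin μ.N → ℝ) : IsPartition (square δ α) (μ.laguerrePartition w) where
  measurableSet i := by
    have : μ.laguerrePartition w i =
        μ.laguerreCell w i ∩ ⋂ j, ⋂ (_ : j < i), (μ.laguerreCell w j)ᶜ := by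
      ext x; simp [laguerrePartition]
    rw [this]
    exact (isClosed_laguerreCell μ hδ h1 w i).measurableSet.inter
      (MeasurableSet.iInter fun j => MeasurableSet.iInter fun _ =>
        (isClosed_laguerreCell μ hδ h1 w j).measurableSet.compl)
  disjoint i j hij := by
    refine Set.disjoint_left.2 fun x hx hx' => ?_
    rcases lt_or_gt_of_ne hij with h | h
    · exact hx'.2 i h hx.1
    · exact hx.2 j h hx'.1
  iUnion_eq := by
    ext x
    rw [Set.mem_iUnion]
    constructor
    · rintro ⟨i, hi⟩
      exact hi.1.1
    · intro hx
      have := N_pos μ hδ h1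
      obtain ⟨i, hi⟩ := Finite.exists_min fun j => ‖x - μ.z j‖ ^ 2 - w j
      obtain ⟨k, hk, hmin⟩ := wellFounded_lt.has_min
        {j : Fin μ.N | x ∈ μ.laguerreCell w j} ⟨i, hx, hi⟩
      exact ⟨k, hk, fun j hj hxj => hmin j hxj hj⟩

theorem laguerreCell_diff_ties_subset (μ : Admissible δ α) (hδ : 0 < δ) (h1 : α < 1)
    (w : Fin μ.N → ℝ) (i : Fin μ.N) :
    μ.laguerreCell w i \ μ.ties w ⊆ μ.laguerrePartition w i := by
  intro x hx
  obtain ⟨j, hj⟩ := (isPartition_laguerrePartition μ hδ h1 w).exists_mem hx.1.1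
  rwa [eq_of_mem_laguerreCell hx.1 hj.1 hx.2]

/-- Breaking ties removes only null lines, which closure restores if the convex cell has interior. A
degenerate cell could be lost altogether, hence `hpos`. -/
theorem closure_laguerrePartition (μ : Admissible δ α) (hδ : 0 < δ) (h1 : α < 1)
    (w : Fin μ.N → ℝ) (i : Fin μ.N) (hpos : volume (μ.laguerrePartition w i) ≠ 0) :
    closure (μ.laguerrePartition w i) = μ.laguerreCell w i := by
  have hcl := isClosed_laguerreCell μ hδ h1 w i
  refine subset_antisymm (closure_minimal (fun x hx => hx.1) hcl) ?_
  have hL : volume (μ.laguerreCell w i) ≠ 0 := fun h =>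
    hpos (measure_mono_null (fun x hx => hx.1) h)
  exact (subset_closure_interior_diff (convex_laguerreCell μ hδ h1 w i) hcl hL
    (volume_ties μ w)).trans (closure_mono ((Set.sdiff_subset_sdiff_left interior_subset).trans
      (laguerreCell_diff_ties_subset μ hδ h1 w i)))

/-- The Laguerre partition minimizes the dual functional among all partitions. -/
theorem sum_moment_laguerre_le (μ : Admissible δ α) (hδ : 0 < δ) (h1 : α < 1)
    (w : Fin μ.N → ℝ) {A : Fin μ.N → Set Plane} (hA : IsPartition (square δ α) A) :
    ∑ i, (moment (μ.laguerrePartition w i) (μ.z i) -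
        w i * volume.real (μ.laguerrePartition w i)) ≤
      ∑ i, (moment (A i) (μ.z i) - w i * volume.real (A i)) ∧
    (∑ i, (moment (μ.laguerrePartition w i) (μ.z i) -
        w i * volume.real (μ.laguerrePartition w i)) =
      ∑ i, (moment (A i) (μ.z i) - w i * volume.real (A i)) →
      ∀ i, volume (A i \ μ.laguerreCell w i) = 0) := by
  have := N_pos μ hδ h1
  have hQ := isCompact_square hδ h1
  have hC := isPartition_laguerrePartition μ hδ h1 w
  have key := sum_setIntegral_le_of_min hQ (h := fun i x => ‖x - μ.z i‖ ^ 2 - w i)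
    (fun i => by fun_prop) hA hC fun i x hx => hx.1.2
  simp only [fun i => setIntegral_power hQ (hA.subset i) (μ.z i) (w i),
    fun i => setIntegral_power hQ (hC.subset i) (μ.z i) (w i)] at key
  refine ⟨key.1, fun h i => ?_⟩
  have h2 := (ae_restrict_iff' (hA.measurableSet i)).1 (key.2 h i)
  refine measure_mono_null (fun x hx => ?_) h2
  intro hall
  exact hx.2 ⟨hA.subset i hx.1, hall hx.1⟩

/-! ### Optimality of the Laguerre cells of a minimizer -/

/-- The weights given by the first variation of the energy with respect to the masses. -/
noncomputable def weight (μ : Admissible δ α) (i : Fin μ.N) : ℝ :=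
  -(c6 / (1 - α) * (α * μ.m i ^ (α - 1)))

/-- The optimal cells of a minimizer. -/
noncomputable def optCell (μ : Admissible δ α) (i : Fin μ.N) : Set Plane :=
  μ.laguerrePartition μ.weight i

theorem isPartition_optCell (μ : Admissible δ α) (hδ : 0 < δ) (h1 : α < 1) :
    IsPartition (square δ α) μ.optCell := isPartition_laguerrePartition μ hδ h1 _

/-- Let V_i be the volumes of the optimal cells and S their total moment. Duality gives W2² ≥ S + ∑
w_i (m_i - V_i), while the cells themselves are a competitor of energy at most K ∑ V_i^α + S. By the
choice of the weights, minimality becomes ∑ (m_i^α + α m_i^(α-1) (V_i - m_i)) ≤ ∑ V_i^α, which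
strict concavity allows only if V = m. The dual bound is then attained. -/
theorem IsMinimizer.volume_optCell_and_W2sq {μ : Admissible δ α} (hμ : μ.IsMinimizer) (hδ : 0 < δ)
    (h0 : 0 < α) (h1 : α < 1) :
    (∀ i, volume.real (μ.optCell i) = μ.m i) ∧
      μ.W2sq = ENNReal.ofReal (∑ i, moment (μ.optCell i) (μ.z i)) := by
  have hC := isPartition_optCell μ hδ h1
  have hQ := isCompact_square hδ h1
  have hKpos : 0 < c6 / (1 - α) := div_pos c6_pos (by linarith)
  set K := c6 / (1 - α) with hK
  set S := ∑ i, moment (μ.optCell i) (μ.z i) with hS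
  have hS0 : 0 ≤ S := Finset.sum_nonneg fun i _ => moment_nonneg _ _
  have hm0 : 0 ≤ K * ∑ i, μ.m i ^ α :=
    mul_nonneg hKpos.le (Finset.sum_nonneg fun i _ => Real.rpow_nonneg (μ.m_pos i).le _)
  obtain ⟨ν, hν⟩ := exists_energy_le_of_isPartition hC hδ h0 h1 μ.z_mem
  have hE := (hμ ν).trans hν
  have hlow : ENNReal.ofReal (S + ∑ i, μ.weight i * (μ.m i - volume.real (μ.optCell i))) ≤
      μ.W2sq := by
    refine le_iInf₂ fun T hT => ?_
    rw [hT.cost_eq hδ h1]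
    apply ENNReal.ofReal_le_ofReal
    have h := (sum_moment_laguerre_le μ hδ h1 μ.weight (hT.isPartition hδ h1)).1
    simp only [hT.volume_cell, Finset.sum_sub_distrib, mul_sub] at h ⊢
    rw [hS]
    unfold optCell
    linarith
  have hfin : μ.W2sq ≠ ⊤ := by
    intro h
    rw [energy, h, add_top, top_le_iff] at hE
    exact ENNReal.ofReal_ne_top hE
  rw [energy, ← ENNReal.ofReal_toReal hfin, ← ENNReal.ofReal_add hm0 ENNReal.toReal_nonneg,
    ENNReal.ofReal_le_ofReal_iff
      (add_nonneg (mul_nonneg hKpos.le (Finset.sum_nonneg fun i _ => by positivity)) hS0)] at hE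
  have hlow' := (ENNReal.ofReal_le_iff_le_toReal hfin).1 hlow
  have hvol : ∀ i, volume.real (μ.optCell i) = μ.m i := by
    by_contra hne
    push Not at hne
    obtain ⟨i, hi⟩ := hne
    have hlt : ∑ i, volume.real (μ.optCell i) ^ α <
        ∑ i, (μ.m i ^ α + α * μ.m i ^ (α - 1) * (volume.real (μ.optCell i) - μ.m i)) :=
      Finset.sum_lt_sum
        (fun j _ => rpow_le_tangent (μ.m_pos j) measureReal_nonneg h0 h1)
        ⟨i, Finset.mem_univ i, rpow_lt_tangent (μ.m_pos i) measureReal_nonneg hi h0 h1⟩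
    have hlt' := mul_lt_mul_of_pos_left hlt hKpos
    rw [Finset.sum_add_distrib, mul_add] at hlt'
    have hw : ∑ i, μ.weight i * (μ.m i - volume.real (μ.optCell i)) =
        K * ∑ i, α * μ.m i ^ (α - 1) * (volume.real (μ.optCell i) - μ.m i) := by
      rw [Finset.mul_sum]
      refine Finset.sum_congr rfl fun j _ => ?_
      rw [weight]; ring
    linarith
  refine ⟨hvol, le_antisymm ?_ ?_⟩
  · obtain ⟨T, hTm, hT⟩ := hC.exists_map μ.z
    have hTT := isTransportMap_of_isPartition hC hδ h1 hTm hT hvol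
    refine (iInf₂_le T hTT).trans_eq ?_
    rw [cost, hC.lintegral_eq hQ μ.z hT]
  · simpa [hvol] using hlow

/-- The energy of a minimizer is at most that of any partition with points in the square. -/
theorem IsMinimizer.energy_le {μ : Admissible δ α} (hμ : μ.IsMinimizer) (hδ : 0 < δ)
    (h0 : 0 < α) (h1 : α < 1) {ι : Type*} [Fintype ι] {A : ι → Set Plane}
    (hA : IsPartition (square δ α) A) {p : ι → Plane} (hp : ∀ i, p i ∈ square δ α) :
    c6 / (1 - α) * ∑ i, μ.m i ^ α + ∑ i, moment (μ.optCell i) (μ.z i) ≤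
      c6 / (1 - α) * ∑ i, volume.real (A i) ^ α + ∑ i, moment (A i) (p i) := by
  have hK : 0 ≤ c6 / (1 - α) := div_nonneg c6_pos.le (by linarith)
  obtain ⟨ν, hν⟩ := exists_energy_le_of_isPartition hA hδ h0 h1 hp
  have hE := (hμ ν).trans hν
  rw [energy, (hμ.volume_optCell_and_W2sq hδ h0 h1).2, ← ENNReal.ofReal_add
    (mul_nonneg hK (Finset.sum_nonneg fun i _ => Real.rpow_nonneg (μ.m_pos i).le _))
    (Finset.sum_nonneg fun i _ => moment_nonneg _ _)] at hE
  rwa [ENNReal.ofReal_le_ofReal_iff (add_nonneg (mul_nonneg hK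
    (Finset.sum_nonneg fun i _ => by positivity))
    (Finset.sum_nonneg fun i _ => moment_nonneg _ _))] at hE

theorem IsMinimizer.volume_optCell {μ : Admissible δ α} (hμ : μ.IsMinimizer) (hδ : 0 < δ)
    (h0 : 0 < α) (h1 : α < 1) (i : Fin μ.N) : volume.real (μ.optCell i) = μ.m i :=
  (hμ.volume_optCell_and_W2sq hδ h0 h1).1 i

theorem IsMinimizer.isOptimalMap {μ : Admissible δ α} (hμ : μ.IsMinimizer) (hδ : 0 < δ)
    (h0 : 0 < α) (h1 : α < 1) {T : Plane → Plane} (hTm : Measurable T)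
    (hT : ∀ i, ∀ x ∈ μ.optCell i, T x = μ.z i) : μ.IsOptimalMap T := by
  have hC := isPartition_optCell μ hδ h1
  refine ⟨isTransportMap_of_isPartition hC hδ h1 hTm hT (hμ.volume_optCell hδ h0 h1), ?_⟩
  rw [(hμ.volume_optCell_and_W2sq hδ h0 h1).2, cost,
    hC.lintegral_eq (isCompact_square hδ h1) μ.z hT]

/-- An optimal map has the same cost and the same cell volumes as the Laguerre partition, so it is
in the equality case of the dual inequality. -/
theorem IsMinimizer.volume_cell_diff {μ : Admissible δ α} (hμ : μ.IsMinimizer) (hδ : 0 < δ)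
    (h0 : 0 < α) (h1 : α < 1) {T : Plane → Plane} (hT : μ.IsOptimalMap T) (i : Fin μ.N) :
    volume (μ.cell T i \ μ.laguerreCell μ.weight i) = 0 := by
  refine (sum_moment_laguerre_le μ hδ h1 μ.weight (hT.1.isPartition hδ h1)).2 ?_ i
  have h := hT.2
  rw [hT.1.cost_eq hδ h1, (hμ.volume_optCell_and_W2sq hδ h0 h1).2,
    ENNReal.ofReal_eq_ofReal_iff (Finset.sum_nonneg fun i _ => moment_nonneg _ _)
      (Finset.sum_nonneg fun i _ => moment_nonneg _ _)] at h
  have hv := hμ.volume_optCell hδ h0 h1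
  unfold optCell at h hv
  simp only [Finset.sum_sub_distrib, hT.1.volume_cell, hv, h]

/-- Every optimal map agrees almost everywhere with one whose cells have Laguerre cells as
closures. -/
theorem IsMinimizer.exists_isLaguerreMap {μ : Admissible δ α} (hμ : μ.IsMinimizer) (hδ : 0 < δ)
    (h0 : 0 < α) (h1 : α < 1) {T : Plane → Plane} (hT : μ.IsOptimalMap T) :
    ∃ T', T' =ᵐ[volume.restrict (square δ α)] T ∧ μ.IsLaguerreMap T' := by
  have hC := isPartition_optCell μ hδ h1
  obtain ⟨T', hTm, hT'⟩ := hC.exists_map μ.z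
  refine ⟨T', ?_, hμ.isOptimalMap hδ h0 h1 hTm hT', μ.weight, fun i => ?_⟩
  · rw [Filter.EventuallyEq, ae_restrict_iff' (measurableSet_square hδ h1)]
    have hnull : volume (μ.ties μ.weight ∪
        ⋃ i, (μ.cell T i \ μ.laguerreCell μ.weight i)) = 0 :=
      measure_union_null (volume_ties μ _)
        (measure_iUnion_null fun i => hμ.volume_cell_diff hδ h0 h1 hT i)
    refine measure_mono_null (fun x hx => ?_) hnull
    by_contra hn
    apply hx
    intro hxQ
    rw [Set.mem_union, not_or, Set.mem_iUnion, not_exists] at hn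
    obtain ⟨i, hi⟩ := hC.exists_mem hxQ
    obtain ⟨j, hj⟩ := (hT.1.isPartition hδ h1).exists_mem hxQ
    have hjL : x ∈ μ.laguerreCell μ.weight j := by
      by_contra hjn
      exact hn.2 j ⟨hj, hjn⟩
    rw [hT' i x hi, hj.2, eq_of_mem_laguerreCell hi.1 hjL hn.1]
  · rw [cell_eq_of_isPartition hC hT' i]
    refine closure_laguerrePartition μ hδ h1 _ i fun h => ?_
    have h2 := hμ.volume_optCell hδ h0 h1 i
    rw [measureReal_def, optCell, h] at h2
    exact (μ.m_pos i).ne h2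

/-- The cells of a normalized optimal map are contained in the Laguerre cells for the weights that
are given by the first variation. -/
theorem IsMinimizer.cell_subset {μ : Admissible δ α} (hμ : μ.IsMinimizer) (hδ : 0 < δ)
    (h0 : 0 < α) (h1 : α < 1) {T : Plane → Plane} (hT : μ.IsLaguerreMap T) (i : Fin μ.N) :
    μ.cell T i ⊆ μ.laguerreCell μ.weight i := by
  obtain ⟨hopt, w, hw⟩ := hT
  have hcell : ∀ k, μ.cell T k ⊆ μ.laguerreCell w k := fun k => hw k ▸ subset_closure
  have hnull : volume (μ.ties w ∪ ⋃ i, (μ.cell T i \ μ.laguerreCell μ.weight i)) = 0 :=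
    measure_union_null (volume_ties μ _)
      (measure_iUnion_null fun i => hμ.volume_cell_diff hδ h0 h1 hopt i)
  have hpos : volume (μ.laguerreCell w i) ≠ 0 := fun h => by
    have h2 := hopt.1.2.2 i
    rw [measure_mono_null (hcell i) h, eq_comm, ENNReal.ofReal_eq_zero] at h2
    exact absurd (μ.m_pos i) (not_lt.2 h2)
  -- The weights `w` need not be `μ.weight`. Off a null set, interior points of the cell for `w` lie
  -- in the closed cell for `μ.weight`; density extends this to the whole cell.
  refine (hcell i).trans ((subset_closure_interior_diff (convex_laguerreCell μ hδ h1 w i)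
    (isClosed_laguerreCell μ hδ h1 w i) hpos hnull).trans
    (closure_minimal (fun y hy => ?_) (isClosed_laguerreCell μ hδ h1 _ i)))
  have hyL := interior_subset hy.1
  have hn := hy.2
  rw [Set.mem_union, not_or, Set.mem_iUnion, not_exists] at hn
  obtain ⟨k, hk⟩ := (hopt.1.isPartition hδ h1).exists_mem hyL.1
  obtain rfl := eq_of_mem_laguerreCell hyL (hcell k hk) hn.1
  by_contra hyn
  exact hn.2 _ ⟨hk, hyn⟩

end Admissible

/-! ### Second moments -/

theorem const_mul_le_moment {Q A : Set Plane} (hQ : IsCompact Q) (hAQ : A ⊆ Q)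
    (hA : MeasurableSet A) {p : Plane} {t : ℝ} (ht : ∀ x ∈ A, t ≤ ‖x - p‖ ^ 2) :
    t * volume.real A ≤ moment A p := by
  have h := setIntegral_mono_on (integrableOn_of_subset_isCompact hQ hAQ continuous_const)
    (integrableOn_of_subset_isCompact hQ hAQ
      (by fun_prop : Continuous fun x : Plane => ‖x - p‖ ^ 2)) hA ht
  rwa [setIntegral_const, smul_eq_mul, mul_comm] at h

theorem moment_le_const_mul {Q A : Set Plane} (hQ : IsCompact Q) (hAQ : A ⊆ Q)
    (hA : MeasurableSet A) {p : Plane} {t : ℝ} (ht : ∀ x ∈ A, ‖x - p‖ ^ 2 ≤ t) :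
    moment A p ≤ t * volume.real A := by
  have h := setIntegral_mono_on (integrableOn_of_subset_isCompact hQ hAQ
      (by fun_prop : Continuous fun x : Plane => ‖x - p‖ ^ 2))
    (integrableOn_of_subset_isCompact hQ hAQ continuous_const) hA ht
  rwa [setIntegral_const, smul_eq_mul, mul_comm t] at *

theorem moment_union {Q A B : Set Plane} (hQ : IsCompact Q) (hAQ : A ⊆ Q) (hBQ : B ⊆ Q)
    (hB : MeasurableSet B) (hd : Disjoint A B) (p : Plane) :
    moment (A ∪ B) p = moment A p + moment B p :=
  setIntegral_union hd hB (integrableOn_of_subset_isCompact hQ hAQ (by fun_prop))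
    (integrableOn_of_subset_isCompact hQ hBQ (by fun_prop))

/-- The parallel axis theorem. -/
theorem moment_eq_moment_centroid {Q A : Set Plane} (hQ : IsCompact Q) (hAQ : A ⊆ Q)
    (hA : volume A ≠ 0) (p : Plane) :
    moment A p = moment A (⨍ x in A, x) + volume.real A * ‖(⨍ x in A, x) - p‖ ^ 2 := by
  set b := ⨍ x in A, x with hb
  have hfin : volume A ≠ ⊤ := ((measure_mono hAQ).trans_lt hQ.measure_lt_top).ne
  have hint : ∀ {f : Plane → ℝ}, Continuous f → IntegrableOn f A := fun hf =>
    integrableOn_of_subset_isCompact hQ hAQ hf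
  have hmean : ∫ x in A, (x - b) = 0 := by
    rw [integral_sub (integrableOn_of_subset_isCompact hQ hAQ continuous_id')
      (integrableOn_of_subset_isCompact hQ hAQ continuous_const), setIntegral_const, hb,
      setAverage_eq, smul_smul, mul_inv_cancel₀, one_smul, sub_self]
    rwa [Ne, measureReal_eq_zero_iff hfin]
  have hcross : ∫ x in A, inner ℝ (b - p) (x - b) = 0 := by
    rw [integral_inner (integrableOn_of_subset_isCompact hQ hAQ (by fun_prop)), hmean,
      inner_zero_right]
  have hexp : ∀ x : Plane, ‖x - p‖ ^ 2 =
      ‖x - b‖ ^ 2 + (2 * inner ℝ (b - p) (x - b) + ‖b - p‖ ^ 2) := fun x => by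
    rw [← sub_add_sub_cancel x b p, norm_add_sq_real, real_inner_comm]
    ring
  have hcongr : moment A p =
      ∫ x in A, (‖x - b‖ ^ 2 + (2 * inner ℝ (b - p) (x - b) + ‖b - p‖ ^ 2)) :=
    integral_congr_ae (ae_of_all _ hexp)
  rw [hcongr, integral_add (hint (by fun_prop)) (hint (by fun_prop)),
    integral_add (hint (by fun_prop)) (hint (by fun_prop)), integral_const_mul, hcross,
    setIntegral_const, smul_eq_mul, mul_zero, zero_add]
  rfl

namespace Admissible

variable {δ α : ℝ}

theorem IsMinimizer.volume_optCell_ne_zero {μ : Admissible δ α} (hμ : μ.IsMinimizer) (hδ : 0 < δ)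
    (h0 : 0 < α) (h1 : α < 1) (i : Fin μ.N) : volume (μ.optCell i) ≠ 0 := fun h => by
  have h2 := hμ.volume_optCell hδ h0 h1 i
  rw [measureReal_def, h] at h2
  exact (μ.m_pos i).ne h2

/-! ### Particle-free balls -/

/-- Inserting a particle at the centre of a particle-free ball does not decrease the energy. -/
theorem IsMinimizer.le_of_ball_disjoint {μ : Admissible δ α} (hμ : μ.IsMinimizer) (hδ : 0 < δ)
    (h0 : 0 < α) (h1 : α < 1) {c : Plane} {r R : ℝ} (hr : 0 < r) (hrR : r < R)
    (hsub : Metric.ball c R ⊆ square δ α) (hdisj : ∀ i, μ.z i ∉ Metric.ball c R) :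
    (R ^ 2 - 2 * R * r) * (Real.pi * r ^ 2) ≤ c6 / (1 - α) * (Real.pi * r ^ 2) ^ α := by
  have hQ := isCompact_square hδ h1
  have hC := isPartition_optCell μ hδ h1
  have hK : 0 ≤ c6 / (1 - α) := div_nonneg c6_pos.le (by linarith)
  set B := Metric.closedBall c r with hB
  have hBm : MeasurableSet B := measurableSet_closedBall
  have hBQ : B ⊆ square δ α := (Metric.closedBall_subset_ball hrR).trans hsub
  have hBv : volume.real B = Real.pi * r ^ 2 := by
    rw [measureReal_def, hB, EuclideanSpace.volume_closedBall_fin_two]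
    rw [ENNReal.toReal_mul, ENNReal.toReal_pow, ENNReal.toReal_ofReal hr.le]
    simp [mul_comm, Real.pi_nonneg]
  -- The index `none` is the new particle at c, which takes B away from the old cells.
  let A : Option (Fin μ.N) → Set Plane := fun o => o.elim B fun i => μ.optCell i \ B
  let p : Option (Fin μ.N) → Plane := fun o => o.elim c μ.z
  have hA : IsPartition (square δ α) A := by
    refine ⟨?_, ?_, ?_⟩
    · rintro (_ | i)
      · exact hBm
      · exact (hC.measurableSet i).diff hBm
    · rintro (_ | i) (_ | j) hij
      · exact absurd rfl hij
      · exact Set.disjoint_left.2 fun x hx hx' => hx'.2 hx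
      · exact Set.disjoint_left.2 fun x hx hx' => hx.2 hx'
      · have hij' : i ≠ j := fun h => hij (h ▸ rfl)
        exact (hC.disjoint hij').mono (fun x hx => hx.1) (fun x hx => hx.1)
    · ext x
      rw [Set.mem_iUnion]
      constructor
      · rintro ⟨_ | i, hx⟩
        · exact hBQ hx
        · exact hC.subset i hx.1
      · intro hx
        by_cases hxB : x ∈ B
        · exact ⟨none, hxB⟩
        · obtain ⟨i, hi⟩ := hC.exists_mem hx
          exact ⟨some i, hi, hxB⟩
  have hp : ∀ o, p o ∈ square δ α := by
    rintro (_ | i)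
    · exact hBQ (Metric.mem_closedBall_self hr.le)
    · exact μ.z_mem i
  have hE := hμ.energy_le hδ h0 h1 hA hp
  rw [Fintype.sum_option, Fintype.sum_option] at hE
  change _ ≤ c6 / (1 - α) * (volume.real B ^ α + ∑ i, volume.real (μ.optCell i \ B) ^ α) +
    (moment B c + ∑ i, moment (μ.optCell i \ B) (μ.z i)) at hE
  have hmass : ∑ i, volume.real (μ.optCell i \ B) ^ α ≤ ∑ i, μ.m i ^ α := by
    refine Finset.sum_le_sum fun i _ => Real.rpow_le_rpow measureReal_nonneg ?_ h0.le
    rw [← hμ.volume_optCell hδ h0 h1 i]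
    exact measureReal_mono (fun x hx => hx.1) (hC.volume_ne_top hQ i)
  have hB' : IsPartition B fun i => μ.optCell i ∩ B :=
    ⟨fun i => (hC.measurableSet i).inter hBm,
      fun i j hij => (hC.disjoint hij).mono (fun x hx => hx.1) (fun x hx => hx.1), by
        rw [← Set.iUnion_inter, hC.iUnion_eq, Set.inter_eq_right.2 hBQ]⟩
  have hmB : moment B c ≤ r ^ 2 * volume.real B := by
    refine moment_le_const_mul hQ hBQ hBm fun x hx => ?_
    rw [hB, Metric.mem_closedBall, dist_eq_norm] at hx
    exact pow_le_pow_left₀ (norm_nonneg _) hx 2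
  have hsplit : ∀ i, moment (μ.optCell i) (μ.z i) =
      moment (μ.optCell i \ B) (μ.z i) + moment (μ.optCell i ∩ B) (μ.z i) := fun i => by
    rw [← moment_union hQ (fun x hx => hC.subset i hx.1) (fun x hx => hC.subset i hx.1)
      ((hC.measurableSet i).inter hBm) (Set.disjoint_left.2 fun x hx hx' => hx.2 hx'.2),
      Set.sdiff_union_inter]
  -- Points of B were transported over a distance of at least R - r and now over at most r; the gain
  -- per unit area is (R - r)² - r² = R² - 2Rr.
  have hlow : (R - r) ^ 2 * volume.real B ≤ ∑ i, moment (μ.optCell i ∩ B) (μ.z i) := by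
    rw [← hB'.sum_volume (isCompact_closedBall c r), Finset.mul_sum]
    refine Finset.sum_le_sum fun i _ => const_mul_le_moment hQ (fun x hx => hC.subset i hx.1)
      (hB'.measurableSet i) fun x hx => ?_
    have hxc : dist x c ≤ r := hx.2
    have hzc : R ≤ dist (μ.z i) c := not_lt.1 (hdisj i)
    have htri := dist_triangle (μ.z i) x c
    rw [dist_comm (μ.z i) x, dist_eq_norm x (μ.z i)] at htri
    exact pow_le_pow_left₀ (by linarith) (by linarith) 2
  simp only [hsplit, Finset.sum_add_distrib] at hE
  rw [hBv] at *
  have hmass' := mul_le_mul_of_nonneg_left hmass hK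
  nlinarith

/-! ### Centroids and distances of particles -/

/-- The particles of a minimizer are the centroids of their cells. -/
theorem IsMinimizer.moment_optCell {μ : Admissible δ α} (hμ : μ.IsMinimizer) (hδ : 0 < δ)
    (h0 : 0 < α) (h1 : α < 1) (i : Fin μ.N) (p : Plane) :
    moment (μ.optCell i) p = moment (μ.optCell i) (μ.z i) + μ.m i * ‖μ.z i - p‖ ^ 2 := by
  classical
  have hQ := isCompact_square hδ h1
  have hC := isPartition_optCell μ hδ h1
  have hne := hμ.volume_optCell_ne_zero hδ h0 h1 i
  have hpar := moment_eq_moment_centroid hQ (hC.subset i) hne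
  rw [hμ.volume_optCell hδ h0 h1 i] at hpar
  set b := ⨍ x in μ.optCell i, x with hb
  have hbQ : b ∈ square δ α :=
    (convex_square hδ h1).set_average_mem (isClosed_square hδ h1) hne (hC.volume_ne_top hQ i)
      ((ae_restrict_iff' (hC.measurableSet i)).2 (ae_of_all _ fun x hx => hC.subset i hx))
      (integrableOn_of_subset_isCompact hQ (hC.subset i) continuous_id)
  -- Moving one particle to the centroid b of its cell saves m_i |b - z_i|², so b = z_i.
  have hE := hμ.energy_le hδ h0 h1 hC (p := Function.update μ.z i b) fun k => by
    rcases eq_or_ne k i with rfl | hk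
    · rwa [Function.update_self]
    · rw [Function.update_of_ne hk]
      exact μ.z_mem k
  simp only [hμ.volume_optCell hδ h0 h1] at hE
  have hsum : ∑ k, moment (μ.optCell k) (Function.update μ.z i b k) -
      ∑ k, moment (μ.optCell k) (μ.z k) =
      moment (μ.optCell i) b - moment (μ.optCell i) (μ.z i) := by
    rw [← Finset.sum_sub_distrib, Fintype.sum_eq_single i, Function.update_self]
    intro k hk
    rw [Function.update_of_ne hk, sub_self]
  have hzb : b = μ.z i := by
    have h := hpar (μ.z i)
    have h2 : μ.m i * ‖b - μ.z i‖ ^ 2 ≤ 0 := by linarith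
    have h3 : ‖b - μ.z i‖ ^ 2 ≤ 0 := by
      by_contra hpos
      exact absurd h2 (not_le.2 (mul_pos (μ.m_pos i) (not_le.1 hpos)))
    have h4 : ‖b - μ.z i‖ = 0 := by
      rw [← sq_eq_zero_iff]
      exact le_antisymm h3 (sq_nonneg _)
    exact sub_eq_zero.1 (norm_eq_zero.1 h4)
  rw [hzb] at hpar
  exact hpar p

/-- Merging two particles at a point of the square does not decrease the energy. -/
theorem IsMinimizer.merge_le {μ : Admissible δ α} (hμ : μ.IsMinimizer) (hδ : 0 < δ)
    (h0 : 0 < α) (h1 : α < 1) {i j : Fin μ.N} (hij : i ≠ j) {p : Plane} (hp : p ∈ square δ α) :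
    c6 / (1 - α) * (μ.m i ^ α + μ.m j ^ α - (μ.m i + μ.m j) ^ α) ≤
      μ.m i * ‖μ.z i - p‖ ^ 2 + μ.m j * ‖μ.z j - p‖ ^ 2 := by
  classical
  have hQ := isCompact_square hδ h1
  have hC := isPartition_optCell μ hδ h1
  have hv := hμ.volume_optCell hδ h0 h1
  -- Cell j is emptied rather than removed, which keeps the index set; its mass term is 0^α = 0.
  let A : Fin μ.N → Set Plane := fun k =>
    if k = i then μ.optCell i ∪ μ.optCell j else if k = j then ∅ else μ.optCell k
  let q : Fin μ.N → Plane := fun k => if k = i then p else μ.z k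
  have hAi : A i = μ.optCell i ∪ μ.optCell j := if_pos rfl
  have hAj : A j = ∅ := by simp [A, hij.symm]
  have hAk : ∀ k, k ≠ i ∧ k ≠ j → A k = μ.optCell k := fun k hk => by simp [A, hk.1, hk.2]
  have hqi : q i = p := if_pos rfl
  have hqk : ∀ k, k ≠ i → q k = μ.z k := fun k hk => if_neg hk
  have hmem : ∀ {k x}, x ∈ A k → ∃ l, x ∈ μ.optCell l ∧ (k = if l = j then i else l) := by
    intro k x hx
    rcases eq_or_ne k i with rfl | hki
    · rw [hAi] at hx
      rcases hx with hx | hx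
      · exact ⟨k, hx, by simp [hij]⟩
      · exact ⟨j, hx, by simp⟩
    · rcases eq_or_ne k j with rfl | hkj
      · rw [hAj] at hx
        exact hx.elim
      · rw [hAk k ⟨hki, hkj⟩] at hx
        exact ⟨k, hx, by simp [hkj]⟩
  have hA : IsPartition (square δ α) A := by
    refine ⟨fun k => ?_, fun k l hkl => ?_, ?_⟩
    · simp only [A]
      split_ifs
      · exact (hC.measurableSet i).union (hC.measurableSet j)
      · exact MeasurableSet.empty
      · exact hC.measurableSet k
    · refine Set.disjoint_left.2 fun x hx hx' => hkl ?_
      obtain ⟨a, ha, rfl⟩ := hmem hx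
      obtain ⟨b, hb, rfl⟩ := hmem hx'
      have : a = b := by
        by_contra hab
        exact Set.disjoint_left.1 (hC.disjoint hab) ha hb
      rw [this]
    · ext x
      rw [Set.mem_iUnion]
      constructor
      · rintro ⟨k, hk⟩
        obtain ⟨l, hl, -⟩ := hmem hk
        exact hC.subset l hl
      · intro hx
        obtain ⟨l, hl⟩ := hC.exists_mem hx
        by_cases hli : l = i
        · exact ⟨i, hAi ▸ Or.inl (hli ▸ hl)⟩
        by_cases hlj : l = j
        · exact ⟨i, hAi ▸ Or.inr (hlj ▸ hl)⟩
        · exact ⟨l, by rwa [hAk l ⟨hli, hlj⟩]⟩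
  have hq : ∀ k, q k ∈ square δ α := fun k => by
    simp only [q]
    split_ifs
    · exact hp
    · exact μ.z_mem k
  have hE := hμ.energy_le hδ h0 h1 hA hq
  have hvi : volume.real (A i) = μ.m i + μ.m j := by
    rw [hAi, measureReal_union (hC.disjoint hij) (hC.measurableSet j) (hC.volume_ne_top hQ i)
      (hC.volume_ne_top hQ j), hv, hv]
  have hvj : volume.real (A j) = 0 := by rw [hAj, measureReal_empty]
  have hmass : ∑ k, volume.real (A k) ^ α - ∑ k, μ.m k ^ α =
      (μ.m i + μ.m j) ^ α - μ.m i ^ α + (0 - μ.m j ^ α) := by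
    rw [← Finset.sum_sub_distrib, Fintype.sum_eq_add i j hij, hvi, hvj, Real.zero_rpow h0.ne']
    intro k hk
    rw [hAk k hk, hv, sub_self]
  have hmom : ∑ k, moment (A k) (q k) - ∑ k, moment (μ.optCell k) (μ.z k) =
      moment (μ.optCell i) p + moment (μ.optCell j) p - moment (μ.optCell i) (μ.z i) +
        (0 - moment (μ.optCell j) (μ.z j)) := by
    rw [← Finset.sum_sub_distrib, Fintype.sum_eq_add i j hij, hAi, hAj, hqi,
      moment_union hQ (hC.subset i) (hC.subset j) (hC.measurableSet j) (hC.disjoint hij),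
      moment_of_volume_eq_zero measure_empty]
    intro k hk
    rw [hAk k hk, hqk k hk.1, sub_self]
  rw [hμ.moment_optCell hδ h0 h1 i p, hμ.moment_optCell hδ h0 h1 j p] at hmom
  have hS : ∑ k, volume.real (A k) ^ α =
      ∑ k, μ.m k ^ α + ((μ.m i + μ.m j) ^ α - μ.m i ^ α + (0 - μ.m j ^ α)) := by linarith
  rw [hS, mul_add] at hE
  linarith

/-- Particles of small mass are far from all other particles. -/
theorem IsMinimizer.le_norm_sub_sq {μ : Admissible δ α} (hμ : μ.IsMinimizer) (hδ : 0 < δ)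
    (h0 : 0 < α) (h1 : α < 1) {i j : Fin μ.N} (hij : i ≠ j) :
    c6 * μ.m i ^ (α - 1) ≤ ‖μ.z i - μ.z j‖ ^ 2 := by
  have ha := μ.m_pos i
  have hb := μ.m_pos j
  set a := μ.m i with hadef
  set b := μ.m j with hbdef
  have hα : 0 < 1 - α := by linarith
  have hK : 0 < c6 / (1 - α) := div_pos c6_pos hα
  have hab : a / (a + b) + b / (a + b) = 1 := by field_simp
  -- The merged particle sits at the centre of mass, where the added moment is the reduced mass
  -- ab/(a+b) times |z_i - z_j|².
  have hp := convex_square hδ h1 (μ.z_mem i) (μ.z_mem j) (by positivity : 0 ≤ a / (a + b))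
    (by positivity : 0 ≤ b / (a + b)) hab
  have hM := hμ.merge_le hδ h0 h1 hij hp
  have e1 : μ.z i - ((a / (a + b)) • μ.z i + (b / (a + b)) • μ.z j) =
      (b / (a + b)) • (μ.z i - μ.z j) := by
    have : a / (a + b) = 1 - b / (a + b) := by linarith
    rw [this]; module
  have e2 : μ.z j - ((a / (a + b)) • μ.z i + (b / (a + b)) • μ.z j) =
      -((a / (a + b)) • (μ.z i - μ.z j)) := by
    have : b / (a + b) = 1 - a / (a + b) := by linarith
    rw [this]; module
  rw [e1, e2, norm_neg, norm_smul, norm_smul, mul_pow, mul_pow, Real.norm_eq_abs, Real.norm_eq_abs,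
    sq_abs, sq_abs, ← hadef, ← hbdef] at hM
  have hD := mul_le_mul_of_nonneg_left (subadditivity_defect ha hb h0 h1) hK.le
  have e3 : a * ((b / (a + b)) ^ 2 * ‖μ.z i - μ.z j‖ ^ 2) +
      b * ((a / (a + b)) ^ 2 * ‖μ.z i - μ.z j‖ ^ 2) =
      (a * b / (a + b)) * ‖μ.z i - μ.z j‖ ^ 2 := by field_simp; ring
  -- The lower bound for the mass saving carries the same reduced mass, which therefore cancels.
  have e4 : c6 / (1 - α) * ((1 - α) * (a ^ α * (b / (a + b)))) =
      (a * b / (a + b)) * (c6 * a ^ (α - 1)) := by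
    rw [Real.rpow_sub_one ha.ne']; field_simp
  rw [e3] at hM
  rw [e4] at hD
  exact le_of_mul_le_mul_left (hD.trans hM) (by positivity)

end Admissible

/-! ### Numerical bounds -/

/-- Turns bounds on powers with exponent k/1000 into comparisons of natural powers of rationals,
which `norm_num` decides. -/
theorem rpow_lt_of_pow_lt_pow {x y : ℝ} (hx : 0 ≤ x) (k : ℕ) (h : x ^ k < y ^ 1000)
    (hy : 0 ≤ y) : x ^ ((k : ℝ) / 1000) < y := by
  by_contra hle
  have h2 := pow_le_pow_left₀ hy (not_lt.1 hle) 1000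
  rw [← Real.rpow_natCast (x ^ ((k : ℝ) / 1000)), ← Real.rpow_mul hx] at h2
  have e : (k : ℝ) / 1000 * ((1000 : ℕ) : ℝ) = k := by norm_num
  rw [e, Real.rpow_natCast] at h2
  linarith

theorem alphaBar_pos : 0 < alphaBar := by norm_num [alphaBar]

theorem alphaBar_lt_one : alphaBar < 1 := by norm_num [alphaBar]

theorem lt_c6 : 0.1603 < c6 := by
  have h : √3 < 1.7321 := by
    rw [Real.sqrt_lt' (by norm_num)]; norm_num
  have h0 : 0 < √3 := by positivity
  rw [c6, lt_div_iff₀ (by positivity)]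
  linarith

theorem c6_lt : c6 < 0.1604 := by
  have h : 1.732 < √3 := by
    rw [Real.lt_sqrt (by norm_num)]; norm_num
  rw [c6, div_lt_iff₀ (by positivity)]
  linarith

/-- Here 417/1000 is 1 - `alphaBar`, and y is a rational upper bound for the corresponding power of
m. -/
theorem lt_c6_mul_rpow {m y t : ℝ} (hm : 0 < m) (hy : 0 < y) (h : m ^ 417 < y ^ 1000)
    (ht : t ≤ 0.1603 / y) : t < c6 * m ^ (alphaBar - 1) := by
  have h1 := rpow_lt_of_pow_lt_pow hm.le 417 h hy.le
  have e : alphaBar - 1 = -((417 : ℕ) / 1000 : ℝ) := by norm_num [alphaBar]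
  rw [e, Real.rpow_neg hm.le, ← div_eq_mul_inv]
  exact ht.trans_lt (div_lt_div₀ lt_c6 h1.le c6_pos.le (Real.rpow_pos_of_pos hm _))

set_option exponentiation.threshold 1000 in
theorem lt_c6_mul_mBar : (2 * 1.17) ^ 2 < c6 * mBar ^ (alphaBar - 1) :=
  lt_c6_mul_rpow (y := 0.0292) (by norm_num [mBar]) (by norm_num) (by norm_num [mBar])
    (by norm_num)

set_option exponentiation.threshold 1000 in
theorem lt_c6_mul_mB : 8 < c6 * mB ^ (alphaBar - 1) :=
  lt_c6_mul_rpow (y := 0.01) (by norm_num [mB]) (by norm_num) (by norm_num [mB]) (by norm_num)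

-- Fixes the constants: R = 1.17 and r = 0.266 make insertion profitable, while R is still small
-- enough for `lt_c6_mul_mBar`.
set_option exponentiation.threshold 1000 in
theorem insertion_energy_lt : c6 / (1 - alphaBar) * (Real.pi * 0.266 ^ 2) ^ alphaBar <
    (1.17 ^ 2 - 2 * 1.17 * 0.266) * (Real.pi * 0.266 ^ 2) := by
  have h1 := Real.pi_gt_d4
  have h2 := Real.pi_lt_d4
  have hv : Real.pi * 0.266 ^ 2 ≤ 0.2223 := by linarith
  have hpow : (Real.pi * 0.266 ^ 2) ^ alphaBar < 0.4165 := by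
    refine (Real.rpow_le_rpow (by positivity) hv alphaBar_pos.le).trans_lt ?_
    have e : alphaBar = ((583 : ℕ) : ℝ) / 1000 := by norm_num [alphaBar]
    rw [e]
    exact rpow_lt_of_pow_lt_pow (by norm_num) 583 (by norm_num) (by norm_num)
  have hK : c6 / (1 - alphaBar) < 0.3847 := by
    rw [div_lt_iff₀ (by norm_num [alphaBar])]
    refine c6_lt.trans_le (by norm_num [alphaBar])
  calc _ ≤ 0.3847 * 0.4165 := mul_le_mul hK.le hpow.le (by positivity) (by norm_num)
    _ < _ := by linarith

theorem exists_forall_le_side : ∃ δ₀ : ℝ, 0 < δ₀ ∧ ∀ δ, 0 < δ → δ < δ₀ →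
    4 * 1.17 ≤ side δ alphaBar := by
  have hα : 0 < 1 - alphaBar := by norm_num [alphaBar]
  have hα2 : 0 < 2 - alphaBar := by norm_num [alphaBar]
  have hc := c6_pos
  -- This δ₀ makes the area at least 25, which exceeds (4 · 1.17)².
  refine ⟨c6 / ((1 - alphaBar) * 25 ^ (2 - alphaBar)), by positivity, fun δ hδ hlt => ?_⟩
  have hvol : 25 ≤ vol δ alphaBar := by
    have h : (25 : ℝ) ^ (2 - alphaBar) ≤ c6 / (δ * (1 - alphaBar)) := by
      rw [lt_div_iff₀ (by positivity)] at hlt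
      rw [le_div_iff₀ (by positivity)]
      linarith
    calc (25 : ℝ) = ((25 : ℝ) ^ (2 - alphaBar)) ^ (1 / (2 - alphaBar)) := by
          rw [← Real.rpow_mul (by norm_num), mul_one_div_cancel hα2.ne', Real.rpow_one]
      _ ≤ vol δ alphaBar := Real.rpow_le_rpow (by positivity) h (by positivity)
  rw [side, ← Real.sqrt_eq_rpow]
  exact Real.le_sqrt_of_sq_le (by norm_num; linarith)

/-! ### Balls in the square -/

theorem ball_subset_square {δ α ρ : ℝ} (hδ : 0 < δ) (h1 : α < 1) {c : Plane}
    (hc : ∀ k, |c k| ≤ side δ α / 2 - ρ) : Metric.ball c ρ ⊆ square δ α := by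
  intro y hy
  rw [mem_square_iff hδ h1]
  intro k
  rw [Metric.mem_ball, dist_eq_norm] at hy
  have h := PiLp.norm_apply_le (y - c) k
  rw [PiLp.sub_apply, Real.norm_eq_abs] at h
  have h2 := abs_le.1 (h.trans hy.le)
  have h3 := abs_le.1 (hc k)
  constructor <;> linarith [h2.1, h2.2, h3.1, h3.2]

theorem exists_ball_subset_square {δ α ρ : ℝ} (hδ : 0 < δ) (h1 : α < 1)
    (hs : 4 * ρ ≤ side δ α) {x : Plane} (hx : x ∈ square δ α) :
    ∃ c, Metric.ball c ρ ⊆ square δ α ∧ ‖x - c‖ ^ 2 = 2 * ρ ^ 2 := by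
  rw [mem_square_iff hδ h1] at hx
  -- Each coordinate is shifted by ρ towards the centre; a side of at least 4ρ keeps it at distance
  -- ρ from both edges.
  refine ⟨WithLp.toLp 2 fun k => if 0 ≤ x k then x k - ρ else x k + ρ,
    ball_subset_square hδ h1 fun k => ?_, ?_⟩
  · have h := hx k
    rw [Set.mem_Icc] at h
    simp only
    rw [abs_le]
    split_ifs with h'
    · constructor <;> linarith
    · constructor <;> linarith
  · rw [EuclideanSpace.real_norm_sq_eq, Fin.sum_univ_two]
    simp only [PiLp.sub_apply]
    split_ifs <;> ring

/-! ### Mass and diameter bounds for minimizers -/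

namespace Admissible

variable {δ : ℝ}

theorem IsMinimizer.exists_mem_ball {μ : Admissible δ alphaBar} (hμ : μ.IsMinimizer) (hδ : 0 < δ)
    {c : Plane} (hc : Metric.ball c 1.17 ⊆ square δ alphaBar) :
    ∃ j, μ.z j ∈ Metric.ball c 1.17 := by
  by_contra hn
  push Not at hn
  have h := hμ.le_of_ball_disjoint hδ alphaBar_pos alphaBar_lt_one (r := 0.266) (by norm_num)
    (by norm_num) hc hn
  exact absurd insertion_energy_lt (not_lt.2 h)

/-- The ball found has its centre at distance √2 · 1.17 from x, so it omits x, and its points are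
within 1.655 + 1.17 < √8. Excluding x matters when x is itself a particle. -/
theorem IsMinimizer.exists_particle_near {μ : Admissible δ alphaBar} (hμ : μ.IsMinimizer)
    (hδ : 0 < δ) (hs : 4 * 1.17 ≤ side δ alphaBar) {x : Plane} (hx : x ∈ square δ alphaBar) :
    ∃ j, μ.z j ≠ x ∧ ‖x - μ.z j‖ ^ 2 ≤ 8 := by
  obtain ⟨c, hc, hxc⟩ := exists_ball_subset_square hδ alphaBar_lt_one hs hx
  obtain ⟨j, hj⟩ := hμ.exists_mem_ball hδ hc
  rw [Metric.mem_ball, dist_eq_norm] at hj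
  refine ⟨j, ?_, ?_⟩
  · intro h
    rw [h] at hj
    have := pow_le_pow_left₀ (norm_nonneg _) hj.le 2
    linarith
  · have hxc' : ‖x - c‖ ≤ 1.655 := by
      rw [← pow_le_pow_iff_left₀ (norm_nonneg _) (by norm_num) two_ne_zero, hxc]
      norm_num
    have htri : ‖x - μ.z j‖ ≤ 1.655 + 1.17 := by
      have := norm_sub_le_norm_sub_add_norm_sub x c (μ.z j)
      rw [norm_sub_rev c] at this
      linarith
    exact (pow_le_pow_left₀ (norm_nonneg _) htri 2).trans (by norm_num)

theorem IsMinimizer.mB_lt {μ : Admissible δ alphaBar} (hμ : μ.IsMinimizer) (hδ : 0 < δ)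
    (hs : 4 * 1.17 ≤ side δ alphaBar) (i : Fin μ.N) : mB < μ.m i := by
  by_contra hle
  obtain ⟨j, hj, hd⟩ := hμ.exists_particle_near hδ hs (μ.z_mem i)
  have hij : i ≠ j := fun h => hj (h ▸ rfl)
  have h := hμ.le_norm_sub_sq hδ alphaBar_pos alphaBar_lt_one hij
  have hmono := Real.rpow_le_rpow_of_nonpos (μ.m_pos i) (not_lt.1 hle)
    (by linarith [alphaBar_lt_one] : alphaBar - 1 ≤ 0)
  have := mul_le_mul_of_nonneg_left hmono c6_pos.le
  linarith [lt_c6_mul_mB]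

theorem IsMinimizer.mBar_lt {μ : Admissible δ alphaBar} (hμ : μ.IsMinimizer) (hδ : 0 < δ)
    (i : Fin μ.N) (hi : 4 ≤ Metric.infDist (μ.z i) (frontier (square δ alphaBar))) :
    mBar < μ.m i := by
  by_contra hle
  have hball := ball_subset_square_of_frontier hδ alphaBar_lt_one (μ.z_mem i) hi
  -- The open ball of radius 1.17 about c has z_i on its boundary, so the particle it contains is
  -- another one, within 2 · 1.17 of z_i. The ball stays in the square since 2 · 1.17 ≤ 4.
  set c : Plane := μ.z i + EuclideanSpace.single 0 1.17 with hcdef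
  have hcz : ‖c - μ.z i‖ = 1.17 := by
    rw [hcdef, add_sub_cancel_left, PiLp.norm_single, Real.norm_eq_abs, abs_of_pos (by norm_num)]
  have hc : Metric.ball c 1.17 ⊆ square δ alphaBar := by
    refine (Metric.ball_subset_ball' ?_).trans hball
    rw [dist_eq_norm, hcz]; norm_num
  obtain ⟨j, hj⟩ := hμ.exists_mem_ball hδ hc
  rw [Metric.mem_ball, dist_eq_norm] at hj
  have hij : i ≠ j := by
    rintro rfl
    rw [norm_sub_rev, hcz] at hj
    exact lt_irrefl _ hj
  have htri : ‖μ.z i - μ.z j‖ ≤ 2 * 1.17 := by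
    have := norm_sub_le_norm_sub_add_norm_sub (μ.z i) c (μ.z j)
    rw [norm_sub_rev (μ.z i) c, norm_sub_rev c (μ.z j)] at this
    linarith
  have hsq := pow_le_pow_left₀ (norm_nonneg _) htri 2
  have h := hμ.le_norm_sub_sq hδ alphaBar_pos alphaBar_lt_one hij
  have hmono := Real.rpow_le_rpow_of_nonpos (μ.m_pos i) (not_lt.1 hle)
    (by linarith [alphaBar_lt_one] : alphaBar - 1 ≤ 0)
  have := mul_le_mul_of_nonneg_left hmono c6_pos.le
  linarith [lt_c6_mul_mBar]

theorem IsMinimizer.diam_cell_le {μ : Admissible δ alphaBar} (hμ : μ.IsMinimizer) (hδ : 0 < δ)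
    (hs : 4 * 1.17 ≤ side δ alphaBar) {T : Plane → Plane} (hT : μ.IsLaguerreMap T)
    (i : Fin μ.N) : Metric.diam (μ.cell T i) ≤ D0 := by
  have hα1 := alphaBar_lt_one
  have hα0 := alphaBar_pos
  have hα : 0 < 1 - alphaBar := by linarith
  have hc := c6_pos
  have hmB : 0 < mB := by norm_num [mB]
  have hrad : ∀ x ∈ μ.cell T i, ‖x - μ.z i‖ ≤
      (8 * R0 ^ 2 + alphaBar / (1 - alphaBar) * c6 * mB ^ (alphaBar - 1)) ^ (1 / 2 : ℝ) := by
    intro x hx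
    have hxL := hμ.cell_subset hδ hα0 hα1 hT i hx
    obtain ⟨j, -, hj⟩ := hμ.exists_particle_near hδ hs hx.1
    -- This reads |x - z_i|² ≤ |x - z_j|² + w_i - w_j, where w_i ≤ 0, the distance term is at most
    -- 8, and `mB_lt` bounds -w_j.
    have h := hxL.2 j
    rw [← Real.sqrt_eq_rpow]
    refine Real.le_sqrt_of_sq_le ?_
    have hmono := Real.rpow_le_rpow_of_nonpos hmB (hμ.mB_lt hδ hs j).le
      (by linarith : alphaBar - 1 ≤ 0)
    have hcoef : 0 ≤ alphaBar / (1 - alphaBar) * c6 := by positivity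
    have hw := mul_le_mul_of_nonneg_left hmono hcoef
    have hwj : -μ.weight j = alphaBar / (1 - alphaBar) * c6 * μ.m j ^ (alphaBar - 1) := by
      rw [weight]; ring
    have hwi : μ.weight i ≤ 0 := by
      have := Real.rpow_nonneg (μ.m_pos i).le (alphaBar - 1)
      rw [weight, neg_nonpos]
      positivity
    have hR : (8 : ℝ) ≤ 8 * R0 ^ 2 := by norm_num [R0]
    linarith
  refine Metric.diam_le_of_forall_dist_le (by rw [D0]; positivity) fun x hx y hy => ?_
  have htri := dist_triangle_right x y (μ.z i)
  rw [dist_eq_norm x (μ.z i), dist_eq_norm y (μ.z i)] at htri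
  rw [D0]
  linarith [hrad x hx, hrad y hy]

end Admissible

end Quantization

open Quantization
theorem lemma4p10 :
    ∃ δ₀ : ℝ, 0 < δ₀ ∧ ∀ δ : ℝ, 0 < δ → δ < δ₀ →
      ∀ μ : Admissible δ alphaBar, μ.IsMinimizer →
        -- masses of cells far from the boundary
        (∀ i, 4 ≤ Metric.infDist (μ.z i) (frontier (square δ alphaBar)) → mBar < μ.m i) ∧
        -- masses of cells close to the boundary
        (∀ i, Metric.infDist (μ.z i) (frontier (square δ alphaBar)) < 4 → mB < μ.m i) ∧
        -- particle-free balls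
        (∀ (x : Plane) (R : ℝ), Metric.ball x R ⊆ square δ alphaBar →
          Metric.ball x R ∩ μ.supp = ∅ → R < R0) ∧
        -- the optimal map exists, can be normalized on a null set, and its cells have
        -- bounded diameter
        (∃ T, μ.IsOptimalMap T) ∧
        (∀ T, μ.IsOptimalMap T →
          ∃ T', T' =ᵐ[volume.restrict (square δ alphaBar)] T ∧ μ.IsLaguerreMap T') ∧
        (∀ T, μ.IsLaguerreMap T → ∀ i, Metric.diam (μ.cell T i) ≤ D0) := by
  obtain ⟨δ₀, hδ₀, hside⟩ := exists_forall_le_side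
  have hα0 := alphaBar_pos
  have hα1 := alphaBar_lt_one
  refine ⟨δ₀, hδ₀, fun δ hδ hlt μ hμ => ⟨fun i hi => hμ.mBar_lt hδ i hi,
    fun i _ => hμ.mB_lt hδ (hside δ hδ hlt) i, fun x R hsub hemp => ?_, ?_,
    fun T hT => hμ.exists_isLaguerreMap hδ hα0 hα1 hT,
    fun T hT i => hμ.diam_cell_le hδ (hside δ hδ hlt) hT i⟩⟩
  -- A particle-free ball with R ≥ `R0` would contain a concentric particle-free ball of radius
  -- 1.17.
  · by_contra hR
    have hle : Metric.ball x 1.17 ⊆ Metric.ball x R :=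
      Metric.ball_subset_ball ((by norm_num [R0] : (1.17 : ℝ) ≤ R0).trans (not_lt.1 hR))
    obtain ⟨j, hj⟩ := hμ.exists_mem_ball hδ (hle.trans hsub)
    exact (Set.eq_empty_iff_forall_notMem.1 hemp) _ ⟨hle hj, j, rfl⟩
  · obtain ⟨T, hTm, hT⟩ := (Admissible.isPartition_optCell μ hδ hα1).exists_map μ.z
    exact ⟨T, hμ.isOptimalMap hδ hα0 hα1 hTm hT⟩
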